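/- Let $E=(E^0,E^1,r,s)$ be a directed graph with finitely many (and at least one) vertices and an arbitrary, possibly infinite, set of edges; loops and parallel edges are allowed. A path is a finite sequence of edges $e_1\cdots e_n$ ($n\ge 1$) with $r(e_i)=s(e_{i+1})$; it goes from $s(e_1)$ to $r(e_n)$, and it is a cycle if $s(e_1)=r(e_n)$. A single vertex counts as a path of length zero. Suppose that $E$ is strongly connected, that is, for all $v,w\in E^0$ there is a path from $v$ to $w$. Give $E^0$ the discrete topology and let $A=C_0(E^0)$. Let $X(E)$ be the $C^*$-correspondence over $A$ of all $\xi:E^1\to\mathbb{C}$ such that $v\mapsto\sum_{r(e)=v}|\xi(e)|^2$ is in $C_0(E^0)$, with $(a\cdot\xi)(e)=a(s(e))\xi(e)$, $(\xi\cdot a)(e)=\xi(e)a(r(e))$ and $\langle\xi,\eta\rangle(v)=\sum_{r(e)=v}\overline{\xi(e)}\eta(e)$. For $n\ge1$ let $X(E)^{\otimes n}$ be the $n$-fold ($A$-balanced, completed) interior tensor product, and let $X(E)^{\otimes 0}=A$ be the identity correspondence, with $\langle a,b\rangle=a^*b$ and with both actions given by multiplication. An isomorphism of $C^*$-correspondences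 is a bijection that preserves the left action and the $A$-valued inner product. Then the following are equivalent: 1. $X(E)$ is nonperiodic: for every integer $n\ge 0$, if $X(E)^{\otimes n}\cong A$ as $C^*$-correspondences, then $n=0$. 2. $E$ is not a simple cycle: there is no $k\ge1$ for which $E^0=\{v_1,\dots,v_k\}$ and $E^1=\{e_1,\dots,e_k\}$, with $k$ distinct vertices and $k$ distinct edges, $s(e_i)=v_i$ and $r(e_i)=v_{i+1}$ for all $i$, where $v_{k+1}=v_1$. 3. $E$ satisfies Condition (L): every cycle $e_1\cdots e_n$ in $E$ has an exit, that is, an edge $f$ with $s(f)=s(e_i)$ and $f\ne e_i$ for some $1\le i\le n$. -/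

import Mathlib

open scoped TensorProduct ZeroAtInfty

noncomputable section

universe u v w w'

/-- The algebraic data of a correspondence over `A` on a complex vector space `M`, without any
completeness or definiteness: an `A`-valued semi-inner product (conjugate-linear in the first
variable), a right action `ract a x = x · a` and a left action `lact a x = a · x` by adjointable
operators. -/
structure PreCorrespondence (A : Type u) [NonUnitalCStarAlgebra A]
    (M : Type w) [AddCommGroup M] [Module ℂ M] where
  inner : M →ₗ⋆[ℂ] M →ₗ[ℂ] A
  ract : A →ₗ[ℂ] M →ₗ[ℂ] M
  lact : A →ₗ[ℂ] M →ₗ[ℂ] M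
  star_inner : ∀ x y, star (inner x y) = inner y x
  /-- positivity of `⟨x, x⟩` in the C*-algebra `A` -/
  inner_self_pos : ∀ x, ∃ b, inner x x = star b * b
  inner_ract : ∀ x y a, inner x (ract a y) = inner x y * a
  ract_mul : ∀ a b x, ract (a * b) x = ract b (ract a x)
  lact_mul : ∀ a b x, lact (a * b) x = lact a (lact b x)
  lact_ract : ∀ a b x, lact a (ract b x) = ract b (lact a x)
  inner_lact : ∀ a x y, inner (lact a x) y = inner x (lact (star a) y)

namespace PreCorrespondence

variable {A : Type u} [NonUnitalCStarAlgebra A]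
variable {M : Type w} [AddCommGroup M] [Module ℂ M]
variable {N : Type w'} [AddCommGroup N] [Module ℂ N]
variable (P : PreCorrespondence A M) (Q : PreCorrespondence A N)

theorem inner_ract_left (x y : M) (a : A) : P.inner (P.ract a x) y = star a * P.inner x y := by
  rw [← P.star_inner, P.inner_ract, star_mul, P.star_inner]

theorem inner_nonneg [PartialOrder A] [StarOrderedRing A] (x : M) : 0 ≤ P.inner x x := by
  obtain ⟨b, hb⟩ := P.inner_self_pos x
  exact hb ▸ star_mul_self_nonneg b

/-- Cauchy-Schwarz. -/
theorem norm_inner_sq_le (x y : M) :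
    ‖P.inner x y‖ ^ 2 ≤ ‖P.inner x x‖ * ‖P.inner y y‖ := by
  let _ := CStarAlgebra.spectralOrder A
  have _ := CStarAlgebra.spectralOrderedRing A
  have key : ∀ c : ℝ, 0 < c → ‖P.inner x x‖ ≤ c → ‖P.inner x y‖ ^ 2 ≤ c * ‖P.inner y y‖ := by
    intro c hc hle
    set a := P.inner x y with ha
    have h1 : star a * P.inner x x * a ≤ c • (star a * a) :=
      (CStarAlgebra.star_left_conjugate_le_norm_smul
        (IsSelfAdjoint.of_nonneg (P.inner_nonneg x))).trans
        (smul_le_smul_of_nonneg_right hle (star_mul_self_nonneg a))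
    have h2 := P.inner_nonneg (P.ract a x - (c : ℂ) • y)
    have h3 : P.inner (P.ract a x - (c : ℂ) • y) (P.ract a x - (c : ℂ) • y)
        = star a * P.inner x x * a - c • (star a * a) - c • (star a * a)
          + (c * c) • P.inner y y := by
      have hyx : P.inner y x = star a := by rw [ha, P.star_inner]
      simp only [map_sub, LinearMap.sub_apply, P.inner_ract, P.inner_ract_left, map_smulₛₗ,
        LinearMap.smul_apply, hyx, ← ha, Complex.conj_ofReal, RingHom.id_apply]
      simp only [Complex.coe_smul]
      module
    rw [h3] at h2
    have h4 : c • (star a * a) ≤ (c * c) • P.inner y y := by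
      have : 0 ≤ c • (star a * a) - c • (star a * a) - c • (star a * a)
          + (c * c) • P.inner y y := h2.trans (by gcongr)
      rw [sub_self, zero_sub, neg_add_eq_sub, sub_nonneg] at this
      exact this
    have h5 := CStarAlgebra.norm_le_norm_of_nonneg_of_le
      (smul_nonneg hc.le (star_mul_self_nonneg a)) h4
    rw [norm_smul, norm_smul, CStarRing.norm_star_mul_self, Real.norm_of_nonneg hc.le,
      Real.norm_of_nonneg (mul_self_nonneg c), mul_assoc] at h5
    have := le_of_mul_le_mul_left h5 hc
    rwa [sq]
  refine le_of_forall_pos_le_add fun ε hε => ?_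
  have h := key (‖P.inner x x‖ + ε / (‖P.inner y y‖ + 1)) (by positivity)
    (le_add_of_nonneg_right (by positivity))
  refine h.trans ?_
  rw [add_mul]
  gcongr
  rw [div_mul_eq_mul_div, div_le_iff₀ (by positivity)]
  nlinarith [norm_nonneg (P.inner y y)]

/-- The seminorm `‖x‖ = ‖⟨x, x⟩‖ ^ (1 / 2)`. -/
def nrm (x : M) : ℝ := √‖P.inner x x‖

theorem nrm_sq (x : M) : P.nrm x ^ 2 = ‖P.inner x x‖ := Real.sq_sqrt (norm_nonneg _)

theorem norm_inner_le (x y : M) : ‖P.inner x y‖ ≤ P.nrm x * P.nrm y := by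
  rw [nrm, nrm, ← Real.sqrt_mul (norm_nonneg _)]
  exact Real.le_sqrt_of_sq_le (P.norm_inner_sq_le x y)

theorem nrm_smul (c : ℂ) (x : M) : P.nrm (c • x) = ‖c‖ * P.nrm x := by
  rw [nrm, LinearMap.map_smulₛₗ₂, map_smul, norm_smul, norm_smul, RCLike.norm_conj,
    ← mul_assoc, Real.sqrt_mul (by positivity), Real.sqrt_mul_self (norm_nonneg _), nrm]

theorem nrm_add_le (x y : M) : P.nrm (x + y) ≤ P.nrm x + P.nrm y := by
  refine Real.sqrt_le_iff.2 ⟨add_nonneg (Real.sqrt_nonneg _) (Real.sqrt_nonneg _), ?_⟩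
  rw [LinearMap.map_add₂, map_add, map_add]
  have h1 := P.norm_inner_le x y
  have h2 := P.norm_inner_le y x
  have h3 := P.nrm_sq x
  have h4 := P.nrm_sq y
  refine (norm_add_le _ _).trans ((add_le_add (norm_add_le _ _) (norm_add_le _ _)).trans ?_)
  nlinarith

/-- The vector space `M` equipped with the seminorm defined by the semi-inner product. -/
def Space (_ : PreCorrespondence A M) : Type w := M

instance : AddCommGroup P.Space := inferInstanceAs (AddCommGroup M)
instance : Module ℂ P.Space := inferInstanceAs (Module ℂ M)
instance : Norm P.Space := ⟨P.nrm⟩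

theorem core : SeminormedSpace.Core ℂ P.Space where
  norm_nonneg _ := Real.sqrt_nonneg _
  norm_smul := P.nrm_smul
  norm_triangle := P.nrm_add_le

instance : SeminormedAddCommGroup P.Space := SeminormedAddCommGroup.ofCore P.core
instance : NormedSpace ℂ P.Space where
  norm_smul_le c x := (P.nrm_smul c x).le

theorem nrm_ract_le (a : A) (x : M) : P.nrm (P.ract a x) ≤ ‖a‖ * P.nrm x := by
  refine Real.sqrt_le_iff.2 ⟨by unfold nrm; positivity, ?_⟩
  rw [P.inner_ract, P.inner_ract_left, mul_pow, P.nrm_sq]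
  refine (norm_mul_le _ _).trans ?_
  have := norm_mul_le (star a) (P.inner x x)
  rw [norm_star] at this
  nlinarith [norm_nonneg a]

theorem exists_defect (a : A) : ∃ d : A, IsSelfAdjoint d ∧
    (2 * ‖a‖) • d - d * d = star a * a := by
  set h := star a * a with hh
  have hsa : IsSelfAdjoint h := .star_mul_self a
  set f : ℝ → ℝ := fun x => ‖a‖ - √(‖a‖ ^ 2 - x) with hf
  have hf0 : f 0 = 0 := by simp [hf]
  have hfc : Continuous f := by fun_prop
  have hspec : ∀ x ∈ quasispectrum ℝ h, x ≤ ‖a‖ ^ 2 := by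
    intro x hx
    have h1 := NonUnitalIsometricContinuousFunctionalCalculus.norm_quasispectrum_le (𝕜 := ℝ) h hx
    rw [hh, CStarRing.norm_star_mul_self, ← sq] at h1
    exact (le_abs_self x).trans h1
  refine ⟨cfcₙ f h, cfcₙ_predicate f h, ?_⟩
  have hc := hfc.continuousOn (s := quasispectrum ℝ h)
  rw [← cfcₙ_mul f f h hc hf0 hc hf0, ← cfcₙ_smul (2 * ‖a‖) f h hc hf0,
    ← cfcₙ_sub (fun x => (2 * ‖a‖) • f x) (fun x => f x * f x) h (by fun_prop) (by simp [hf0])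
      (by fun_prop) (by simp [hf0])]
  conv_rhs => rw [← cfcₙ_id ℝ h]
  refine cfcₙ_congr fun x hx => ?_
  have := Real.sq_sqrt (sub_nonneg.2 (hspec x hx))
  simp only [hf, smul_eq_mul, id]
  nlinarith

theorem nrm_lact_le (a : A) (x : M) : P.nrm (P.lact a x) ≤ ‖a‖ * P.nrm x := by
  let _ := CStarAlgebra.spectralOrder A
  have _ := CStarAlgebra.spectralOrderedRing A
  obtain ⟨d, hd, hda⟩ := exists_defect a
  have h1 := P.inner_nonneg ((‖a‖ : ℂ) • x - P.lact d x)
  have h2 : P.inner ((‖a‖ : ℂ) • x - P.lact d x) ((‖a‖ : ℂ) • x - P.lact d x)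
      = (‖a‖ ^ 2) • P.inner x x - P.inner (P.lact a x) (P.lact a x) := by
    have e : P.inner (P.lact a x) (P.lact a x)
        = (2 * ‖a‖) • P.inner x (P.lact d x) - P.inner x (P.lact d (P.lact d x)) := by
      rw [P.inner_lact, ← P.lact_mul, ← hda, ← P.lact_mul, map_sub, LinearMap.sub_apply, map_sub,
        ← Complex.coe_smul, map_smul, LinearMap.smul_apply, map_smul, Complex.coe_smul]
    rw [e]
    simp only [map_sub, LinearMap.sub_apply, map_smulₛₗ, LinearMap.smul_apply,
      P.inner_lact, hd.star_eq, Complex.conj_ofReal, RingHom.id_apply]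
    simp only [Complex.coe_smul]
    module
  rw [h2, sub_nonneg] at h1
  have h3 := CStarAlgebra.norm_le_norm_of_nonneg_of_le (P.inner_nonneg _) h1
  refine Real.sqrt_le_iff.2 ⟨by unfold nrm; positivity, ?_⟩
  rw [mul_pow, P.nrm_sq]
  rwa [norm_smul, Real.norm_of_nonneg (by positivity)] at h3


theorem exists_negative_part {C : Type*} [NonUnitalCStarAlgebra C] {G : C}
    (hG : IsSelfAdjoint G) : ∃ m c : C, IsSelfAdjoint m ∧ m * G * m = -(m * m * m) ∧
      m * m * m = star c * c ∧ (c = 0 → ∃ B, G = star B * B) := by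
  let _ := CStarAlgebra.spectralOrder C
  have _ := CStarAlgebra.spectralOrderedRing C
  have hm0 : 0 ≤ G⁻ := CFC.negPart_nonneg G
  have hms : IsSelfAdjoint G⁻ := .of_nonneg hm0
  have hm3 : 0 ≤ G⁻ * G⁻ * G⁻ := by
    have := star_left_conjugate_nonneg hm0 G⁻
    rwa [hms.star_eq] at this
  obtain ⟨c, hc⟩ := CStarAlgebra.nonneg_iff_eq_star_mul_self.1 hm3
  refine ⟨G⁻, c, hms, ?_, hc, fun hc0 => ?_⟩
  · conv_lhs => rw [mul_assoc, ← CFC.posPart_sub_negPart G hG]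
    rw [CFC.posPart_sub_negPart G hG, ← mul_assoc]
    nth_rw 2 [← CFC.posPart_sub_negPart G hG]
    rw [mul_sub, CFC.negPart_mul_posPart, zero_sub, neg_mul]
  · have hm3z : G⁻ * G⁻ * G⁻ = 0 := by rw [hc, hc0, mul_zero]
    have hm2 : G⁻ * G⁻ = 0 := by
      rw [← CStarRing.star_mul_self_eq_zero_iff, star_mul, hms.star_eq, ← mul_assoc, hm3z,
        zero_mul]
    have hmz : G⁻ = 0 := by
      rw [← CStarRing.star_mul_self_eq_zero_iff, hms.star_eq, hm2]
    exact CStarAlgebra.nonneg_iff_eq_star_mul_self.1 ((CFC.negPart_eq_zero_iff G hG).1 hmz)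

theorem exists_gram_factor {k : ℕ} (x : Fin k → M) : ∃ B : Fin k → Fin k → A,
    ∀ i j, P.inner (x i) (x j) = ∑ l, star (B l i) * B l j := by
  let _ := CStarAlgebra.spectralOrder A
  have _ := CStarAlgebra.spectralOrderedRing A
  let G : CStarMatrix (Fin k) (Fin k) A := CStarMatrix.ofMatrix fun i j => P.inner (x i) (x j)
  have hG : ∀ i j, G i j = P.inner (x i) (x j) := fun _ _ => rfl
  have hGs : IsSelfAdjoint G := by
    ext i j
    rw [CStarMatrix.star_apply, hG, hG, P.star_inner]
  obtain ⟨m, c, hms, hmGm, hc, himp⟩ := exists_negative_part hGs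
  have hpos : ∀ l, 0 ≤ (m * G * m) l l := by
    intro l
    have h := P.inner_nonneg (∑ i, P.ract (m i l) (x i))
    convert h using 1
    simp only [CStarMatrix.mul_apply, map_sum, LinearMap.sum_apply, P.inner_ract,
      P.inner_ract_left, hG, Finset.sum_mul]
    refine Finset.sum_congr rfl fun j _ => Finset.sum_congr rfl fun i _ => ?_
    rw [CStarMatrix.star_apply_of_isSelfAdjoint hms]
  have hc0 : c = 0 := by
    ext i l
    have h1 : ∑ j, star (c j l) * c j l = 0 := by
      have h2 : (m * m * m) l l = ∑ j, star (c j l) * c j l := by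
        rw [hc, CStarMatrix.mul_apply]
        rfl
      have h3 := hpos l
      rw [hmGm] at h3
      have h4 : (m * m * m) l l ≤ 0 := neg_nonneg.1 h3
      exact le_antisymm (h2 ▸ h4) (Finset.sum_nonneg fun j _ => star_mul_self_nonneg _)
    have h5 := (Finset.sum_eq_zero_iff_of_nonneg fun j _ => star_mul_self_nonneg (c j l)).1 h1 i
      (Finset.mem_univ i)
    exact (CStarRing.star_mul_self_eq_zero_iff _).1 h5
  obtain ⟨B, hB⟩ := himp hc0
  refine ⟨fun i j => B i j, fun i j => ?_⟩
  rw [← hG, hB, CStarMatrix.mul_apply]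
  rfl

/-- The sesquilinear form on `M ⊗ N` with
`⟨x ⊗ y, x' ⊗ y'⟩ = ⟨y, ⟨x, x'⟩ · y'⟩`. -/
def tensorInner : M ⊗[ℂ] N →ₗ⋆[ℂ] M ⊗[ℂ] N →ₗ[ℂ] A :=
  TensorProduct.lift <| LinearMap.mk₂'ₛₗ (starRingEnd ℂ) (starRingEnd ℂ)
    (fun x y => TensorProduct.lift ((Q.lact ∘ₗ P.inner x).compr₂ (Q.inner y)))
    (fun _ _ _ => by ext; simp) (fun _ _ _ => by ext; simp)
    (fun _ _ _ => by ext; simp) (fun _ _ _ => by ext; simp)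

@[simp]
theorem tensorInner_tmul (x x' : M) (y y' : N) :
    tensorInner P Q (x ⊗ₜ y) (x' ⊗ₜ y') = Q.inner y (Q.lact (P.inner x x') y') := rfl

theorem tensorInner_self_pos (t : M ⊗[ℂ] N) : ∃ b, tensorInner P Q t t = star b * b := by
  let _ := CStarAlgebra.spectralOrder A
  have _ := CStarAlgebra.spectralOrderedRing A
  rw [← CStarAlgebra.nonneg_iff_eq_star_mul_self]
  obtain ⟨k, x, y, rfl⟩ := TensorProduct.exists_sum_tmul_eq t
  obtain ⟨B, hB⟩ := P.exists_gram_factor x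
  have h : tensorInner P Q (∑ j, x j ⊗ₜ y j) (∑ j, x j ⊗ₜ y j)
      = ∑ l, Q.inner (∑ i, Q.lact (B l i) (y i)) (∑ i, Q.lact (B l i) (y i)) := by
    simp only [map_sum, LinearMap.sum_apply, tensorInner_tmul, hB, Q.inner_lact, Q.lact_mul]
    conv_rhs => rw [Finset.sum_comm]
    refine Finset.sum_congr rfl fun j _ => ?_
    rw [Finset.sum_comm]
  rw [h]
  exact Finset.sum_nonneg fun l _ => Q.inner_nonneg _

/-- The algebraic interior tensor product: the semi-inner product, the right action
`(x ⊗ y) · a = x ⊗ (y · a)` and the left action `a · (x ⊗ y) = (a · x) ⊗ y` on `M ⊗ N`. The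
vectors `(x · a) ⊗ y - x ⊗ (a · y)` have seminorm zero, so that the Hausdorff completion is
`A`-balanced. -/
def tensor : PreCorrespondence A (M ⊗[ℂ] N) where
  inner := tensorInner P Q
  ract := LinearMap.lTensorHom M ∘ₗ Q.ract
  lact := LinearMap.rTensorHom N ∘ₗ P.lact
  star_inner s t := by
    induction s with
    | zero => simp
    | add s₁ s₂ h₁ h₂ => simp [h₁, h₂]
    | tmul x y =>
      induction t with
      | zero => simp
      | add t₁ t₂ h₁ h₂ => simp [h₁, h₂]
      | tmul x' y' =>
        rw [tensorInner_tmul, tensorInner_tmul, Q.star_inner, Q.inner_lact, P.star_inner]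
  inner_self_pos := tensorInner_self_pos P Q
  inner_ract s t a := by
    induction s with
    | zero => simp
    | add s₁ s₂ h₁ h₂ => rw [LinearMap.map_add₂, h₁, h₂, LinearMap.map_add₂, add_mul]
    | tmul x y =>
      induction t with
      | zero => simp
      | add t₁ t₂ h₁ h₂ => simp only [map_add, h₁, h₂, add_mul]
      | tmul x' y' => simp [Q.lact_ract, Q.inner_ract]
  ract_mul a b t := by
    induction t with
    | zero => simp
    | add t₁ t₂ h₁ h₂ => simp only [map_add, h₁, h₂]
    | tmul x y => simp [Q.ract_mul]
  lact_mul a b t := by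
    induction t with
    | zero => simp
    | add t₁ t₂ h₁ h₂ => simp only [map_add, h₁, h₂]
    | tmul x y => simp [P.lact_mul]
  lact_ract a b t := by
    induction t with
    | zero => simp
    | add t₁ t₂ h₁ h₂ => simp only [map_add, h₁, h₂]
    | tmul x y => simp
  inner_lact a s t := by
    induction s with
    | zero => simp
    | add s₁ s₂ h₁ h₂ => rw [map_add, LinearMap.map_add₂, h₁, h₂, LinearMap.map_add₂]
    | tmul x y =>
      induction t with
      | zero => simp
      | add t₁ t₂ h₁ h₂ => simp only [map_add, h₁, h₂]
      | tmul x' y' => simp [P.inner_lact]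

/-! ### Hausdorff completion -/

/-- The structure `P`, viewed on the seminormed space `P.Space`. -/
def onSpace : PreCorrespondence A P.Space := P

theorem norm_inner_space_le (x y : P.Space) : ‖P.onSpace.inner x y‖ ≤ ‖x‖ * ‖y‖ :=
  P.norm_inner_le x y

theorem norm_ract_space_le (a : A) (x : P.Space) : ‖P.onSpace.ract a x‖ ≤ ‖a‖ * ‖x‖ :=
  P.nrm_ract_le a x

theorem norm_lact_space_le (a : A) (x : P.Space) : ‖P.onSpace.lact a x‖ ≤ ‖a‖ * ‖x‖ :=
  P.nrm_lact_le a x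

open UniformSpace in
/-- The `A`-valued inner product on the Hausdorff completion, extended by continuity. -/
def complInner : Completion P.Space → Completion P.Space → A :=
  Function.curry <| (Completion.isDenseInducing_coe.prodMap Completion.isDenseInducing_coe).extend
    (fun p : P.Space × P.Space => P.onSpace.inner p.1 p.2)

theorem continuous_inner_space : Continuous fun p : P.Space × P.Space => P.onSpace.inner p.1 p.2 := by
  have hf : ∀ x y, ‖P.onSpace.inner x y‖ ≤ 1 * ‖x‖ * ‖y‖ := fun x y => by
    rw [one_mul]; exact P.norm_inner_space_le x y
  exact ((P.onSpace.inner.mkContinuous₂ 1 hf).continuous.comp continuous_fst).clm_apply continuous_snd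

open UniformSpace in
theorem complInner_coe (x y : P.Space) :
    P.complInner (x : Completion P.Space) (y : Completion P.Space) = P.onSpace.inner x y :=
  (Completion.isDenseInducing_coe.prodMap Completion.isDenseInducing_coe).extend_eq
    P.continuous_inner_space (x, y)

open UniformSpace in
theorem continuous_complInner :
    Continuous fun p : Completion P.Space × Completion P.Space => P.complInner p.1 p.2 := by
  let inner' : P.Space →+ P.Space →+ A :=
    { toFun := fun x => (P.onSpace.inner x).toAddMonoidHom
      map_zero' := by ext x; exact LinearMap.map_zero₂ P.onSpace.inner x
      map_add' := fun x y => by ext z; exact LinearMap.map_add₂ P.onSpace.inner x y z }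
  have : Continuous fun p : P.Space × P.Space => inner' p.1 p.2 := P.continuous_inner_space
  exact (Completion.isDenseInducing_toCompl P.Space).extend_Z_bilin
    (Completion.isDenseInducing_toCompl P.Space) this

section Act

open UniformSpace

variable {P}
variable {f : A →ₗ[ℂ] P.Space →ₗ[ℂ] P.Space} (hf : ∀ a x, ‖f a x‖ ≤ ‖a‖ * ‖x‖)

/-- An operator of a bounded linear action of `A`, extended to the Hausdorff completion. -/
def complOp (a : A) : Completion P.Space →L[ℂ] Completion P.Space :=
  ((Completion.toComplL (𝕜 := ℂ) (E := P.Space)).comp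
    ((f a).mkContinuous ‖a‖ (hf a))).extend
    Completion.toComplL

theorem complOp_coe (a : A) (x : P.Space) :
    complOp hf a (x : Completion P.Space) = (f a x : Completion P.Space) :=
  ContinuousLinearMap.extend_eq _ Completion.denseRange_coe
    (Completion.isUniformInducing_coe P.Space) x

/-- A bounded linear action of `A`, extended to the Hausdorff completion. -/
def complAct : A →ₗ[ℂ] Completion P.Space →ₗ[ℂ] Completion P.Space where
  toFun a := complOp hf a
  map_add' a b := by
    ext x
    induction x using Completion.induction_on with
    | hp =>
      exact isClosed_eq (complOp hf (a + b)).continuous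
              ((complOp hf a).continuous.add (complOp hf b).continuous)
    | ih x =>
      change complOp hf (a + b) _ = complOp hf a _ + complOp hf b _
      rw [complOp_coe, complOp_coe, complOp_coe, map_add]
      exact Completion.coe_add (α := P.Space) (f a x) (f b x)
  map_smul' c a := by
    ext x
    induction x using Completion.induction_on with
    | hp =>
      exact isClosed_eq (complOp hf (c • a)).continuous
              ((complOp hf a).continuous.const_smul c)
    | ih x =>
      change complOp hf (c • a) _ = c • complOp hf a _
      rw [complOp_coe, complOp_coe, map_smul]
      exact Completion.coe_smul (X := P.Space) c (f a x)

theorem complAct_coe (a : A) (x : P.Space) :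
    complAct hf a (x : Completion P.Space) = (f a x : Completion P.Space) :=
  complOp_coe hf a x

theorem continuous_complAct (a : A) : Continuous (complAct hf a) :=
  (complOp hf a).continuous

end Act

theorem continuous_complInner_comp {T : Type*} [TopologicalSpace T]
    {f g : T → UniformSpace.Completion P.Space} (hf : Continuous f) (hg : Continuous g) :
    Continuous fun t => P.complInner (f t) (g t) :=
  P.continuous_complInner.comp (hf.prodMk hg)

open UniformSpace in
theorem star_complInner (x y : Completion P.Space) :
    star (P.complInner x y) = P.complInner y x := by
  induction x, y using Completion.induction_on₂ with
  | hp =>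
    exact isClosed_eq (P.continuous_complInner_comp continuous_fst continuous_snd).star
      (P.continuous_complInner_comp continuous_snd continuous_fst)
  | ih x y =>
    simp only [complInner_coe]
    exact P.onSpace.star_inner x y

open UniformSpace in
/-- `complInner` as a sesquilinear map. -/
def complInnerₗ : Completion P.Space →ₗ⋆[ℂ] Completion P.Space →ₗ[ℂ] A :=
  have hr : ∀ x y z, P.complInner x (y + z) = P.complInner x y + P.complInner x z := by
    intro x y z
    induction x, y, z using Completion.induction_on₃ with
    | hp =>
      exact isClosed_eq (P.continuous_complInner_comp (by fun_prop) (by fun_prop))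
        ((P.continuous_complInner_comp (by fun_prop) (by fun_prop)).add
          (P.continuous_complInner_comp (by fun_prop) (by fun_prop)))
    | ih x y z =>
      rw [← Completion.coe_add]
      simp only [complInner_coe]
      exact map_add (P.onSpace.inner x) y z
  have hrs : ∀ (c : ℂ) x y, P.complInner x (c • y) = c • P.complInner x y := by
    intro c x y
    induction x, y using Completion.induction_on₂ with
    | hp =>
      exact isClosed_eq
        (P.continuous_complInner_comp continuous_fst (continuous_snd.const_smul c))
        ((P.continuous_complInner_comp continuous_fst continuous_snd).const_smul c)
    | ih x y =>
      rw [← Completion.coe_smul]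
      simp only [complInner_coe]
      exact map_smul (P.onSpace.inner x) c y
  LinearMap.mk₂'ₛₗ (starRingEnd ℂ) (RingHom.id ℂ) P.complInner
    (fun x y z => by
      rw [← P.star_complInner, hr, star_add, P.star_complInner, P.star_complInner])
    (fun c x y => by
      rw [← P.star_complInner, hrs, star_smul, P.star_complInner]; rfl)
    (fun x y z => hr x y z) (fun c x y => hrs c x y)

open UniformSpace in
/-- The extension of the structure of `M` to its Hausdorff completion by continuity. -/
def completionPre : PreCorrespondence A (Completion P.Space) where
  inner := P.complInnerₗ
  ract := complAct P.norm_ract_space_le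
  lact := complAct P.norm_lact_space_le
  star_inner := P.star_complInner
  inner_self_pos x := by
    let _ := CStarAlgebra.spectralOrder A
    have _ := CStarAlgebra.spectralOrderedRing A
    rw [← CStarAlgebra.nonneg_iff_eq_star_mul_self]
    change 0 ≤ P.complInner x x
    induction x using Completion.induction_on with
    | hp =>
      exact (CStarAlgebra.isClosed_nonneg (A := A)).preimage
        (P.continuous_complInner_comp continuous_id continuous_id)
    | ih x =>
      rw [complInner_coe]
      exact P.onSpace.inner_nonneg x
  inner_ract x y a := by
    change P.complInner x (complAct P.norm_ract_space_le a y) = P.complInner x y * a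
    induction x, y using Completion.induction_on₂ with
    | hp =>
      exact isClosed_eq
        (P.continuous_complInner_comp continuous_fst
          ((continuous_complAct P.norm_ract_space_le a).comp continuous_snd))
        ((P.continuous_complInner_comp continuous_fst continuous_snd).mul continuous_const)
    | ih x y =>
      rw [complAct_coe, complInner_coe, complInner_coe]
      exact P.onSpace.inner_ract x y a
  ract_mul a b x := by
    induction x using Completion.induction_on with
    | hp =>
      exact isClosed_eq (continuous_complAct _ _)
        ((continuous_complAct _ _).comp (continuous_complAct _ _))
    | ih x =>
      simp only [complAct_coe, P.onSpace.ract_mul]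
  lact_mul a b x := by
    induction x using Completion.induction_on with
    | hp =>
      exact isClosed_eq (continuous_complAct _ _)
        ((continuous_complAct _ _).comp (continuous_complAct _ _))
    | ih x =>
      simp only [complAct_coe, P.onSpace.lact_mul]
  lact_ract a b x := by
    induction x using Completion.induction_on with
    | hp =>
      exact isClosed_eq ((continuous_complAct _ _).comp (continuous_complAct _ _))
        ((continuous_complAct _ _).comp (continuous_complAct _ _))
    | ih x =>
      simp only [complAct_coe, P.onSpace.lact_ract]
  inner_lact a x y := by
    change P.complInner (complAct P.norm_lact_space_le a x) y
      = P.complInner x (complAct P.norm_lact_space_le (star a) y)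
    induction x, y using Completion.induction_on₂ with
    | hp =>
      exact isClosed_eq
        (P.continuous_complInner_comp
          ((continuous_complAct P.norm_lact_space_le a).comp continuous_fst) continuous_snd)
        (P.continuous_complInner_comp continuous_fst
          ((continuous_complAct P.norm_lact_space_le (star a)).comp continuous_snd))
    | ih x y =>
      rw [complAct_coe, complAct_coe, complInner_coe, complInner_coe]
      exact P.onSpace.inner_lact a x y

end PreCorrespondence

/-- A C*-correspondence over `A`: a right Hilbert `A`-module (complete for the norm
`‖x‖ = ‖⟨x, x⟩‖ ^ (1 / 2)`) with a left action of `A` by adjointable operators. -/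
structure CStarCorrespondence (A : Type u) [NonUnitalCStarAlgebra A] where
  Carrier : Type w
  [normedAddCommGroup : NormedAddCommGroup Carrier]
  [normedSpace : NormedSpace ℂ Carrier]
  [completeSpace : CompleteSpace Carrier]
  toPre : PreCorrespondence A Carrier
  norm_sq_eq : ∀ x, ‖x‖ ^ 2 = ‖toPre.inner x x‖

attribute [instance] CStarCorrespondence.normedAddCommGroup CStarCorrespondence.normedSpace
  CStarCorrespondence.completeSpace

/-- The Hausdorff completion of a semi-inner product correspondence. -/
def PreCorrespondence.completion {A : Type u} [NonUnitalCStarAlgebra A] {M : Type w}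
    [AddCommGroup M] [Module ℂ M] (P : PreCorrespondence A M) : CStarCorrespondence.{u, w} A where
  Carrier := UniformSpace.Completion P.Space
  toPre := P.completionPre
  norm_sq_eq x := by
    change ‖x‖ ^ 2 = ‖P.complInner x x‖
    induction x using UniformSpace.Completion.induction_on with
    | hp =>
      exact isClosed_eq (continuous_norm.pow 2)
        (P.continuous_complInner_comp continuous_id continuous_id).norm
    | ih x =>
      rw [P.complInner_coe, UniformSpace.Completion.norm_coe]
      exact P.nrm_sq x

namespace CStarCorrespondence

variable {A : Type u} [NonUnitalCStarAlgebra A]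

/-- The identity correspondence `A` over `A`: multiplication actions and `⟨a, b⟩ = a* b`. -/
def self (A : Type u) [NonUnitalCStarAlgebra A] : CStarCorrespondence.{u, u} A where
  Carrier := A
  toPre :=
    { inner := LinearMap.mk₂'ₛₗ (starRingEnd ℂ) (RingHom.id ℂ) (fun a b => star a * b)
        (by simp [add_mul]) (by simp [smul_mul_assoc]) (by simp [mul_add])
        (by simp [mul_smul_comm])
      ract := (LinearMap.mul ℂ A).flip
      lact := LinearMap.mul ℂ A
      star_inner := by simp
      inner_self_pos := fun a => ⟨a, rfl⟩
      inner_ract := by simp [mul_assoc]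
      ract_mul := by simp [mul_assoc]
      lact_mul := by simp [mul_assoc]
      lact_ract := by simp [mul_assoc]
      inner_lact := by simp [mul_assoc] }
  norm_sq_eq a := by
    change _ = ‖star a * a‖
    rw [CStarRing.norm_star_mul_self, sq]

/-- The interior (`A`-balanced, completed) tensor product `X ⊗_A Y`. -/
def tensor (X : CStarCorrespondence.{u, w} A) (Y : CStarCorrespondence.{u, w'} A) :
    CStarCorrespondence.{u, max w w'} A :=
  (X.toPre.tensor Y.toPre).completion

/-- The tensor power `X^{⊗ (n + 1)} = X ⊗_A (X ⊗_A (⋯ ⊗_A X))` with `n + 1` factors. -/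
def tensorPowSucc (X : CStarCorrespondence.{u, w} A) : ℕ → CStarCorrespondence.{u, w} A
  | 0 => X
  | n + 1 => X.tensor (X.tensorPowSucc n)

/-- `X ≅ Y` as C*-correspondences: there is a bijection that preserves the left action and the
inner product (it is then automatically linear and preserves the right action). -/
def IsIsomorphic (X : CStarCorrespondence.{u, w} A) (Y : CStarCorrespondence.{u, w'} A) : Prop :=
  ∃ Φ : X.Carrier → Y.Carrier, Function.Bijective Φ ∧
    (∀ a x, Φ (X.toPre.lact a x) = Y.toPre.lact a (Φ x)) ∧
    ∀ x x', Y.toPre.inner (Φ x) (Φ x') = X.toPre.inner x x'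

/-- `X^{⊗ n} ≅ A` as C*-correspondences, where `X^{⊗ 0}` is the identity correspondence `A`. -/
def TensorPowIsoSelf (X : CStarCorrespondence.{u, w} A) : ℕ → Prop
  | 0 => (self A).IsIsomorphic (self A)
  | n + 1 => (X.tensorPowSucc n).IsIsomorphic (self A)

/-- `X` is nonperiodic: `X^{⊗ n} ≅ A` implies `n = 0`. -/
def Nonperiodic (X : CStarCorrespondence.{u, w} A) : Prop :=
  ∀ n : ℕ, X.TensorPowIsoSelf n → n = 0

end CStarCorrespondence

/-- A definite and complete semi-inner product correspondence is a C*-correspondence. -/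
def PreCorrespondence.toCStar {A : Type u} [NonUnitalCStarAlgebra A] {M : Type w}
    [AddCommGroup M] [Module ℂ M] (P : PreCorrespondence A M)
    (hdef : ∀ x, P.inner x x = 0 → x = 0) (hcomplete : CompleteSpace P.Space) :
    CStarCorrespondence.{u, w} A where
  Carrier := P.Space
  normedAddCommGroup := NormedAddCommGroup.ofSeparation fun x hx => hdef x <| by
    have h := P.nrm_sq x
    rw [show P.nrm x = 0 from hx] at h
    exact norm_eq_zero.1 (by simpa using h.symm)
  normedSpace := { norm_smul_le := fun c x => (P.nrm_smul c x).le }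
  completeSpace := hcomplete
  toPre := P.onSpace
  norm_sq_eq := P.nrm_sq

/-! ### Directed graphs -/

/-- A directed graph `(E⁰, E¹, r, s)` with vertex set `V = E⁰` and edge set `E = E¹`; loops and
(possibly infinitely many) parallel edges are allowed. -/
structure DirectedGraph (V : Type u) (E : Type v) where
  r : E → V
  s : E → V

namespace DirectedGraph

variable {V : Type u} {E : Type v} (G : DirectedGraph V E)

section Correspondence

variable [TopologicalSpace V]

/-- `v ↦ ∑_{r(e) = v} g(e)` (sums converging unconditionally) is a function in `C₀(E⁰)`. -/
def FiberSumsC0 (g : E → ℝ) : Prop :=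
  ∃ f : C₀(V, ℝ), ∀ v, HasSum (fun e : {e : E // G.r e = v} => g e) (f v)

variable {G}

theorem FiberSumsC0.add {g h : E → ℝ} (hg : G.FiberSumsC0 g) (hh : G.FiberSumsC0 h) :
    G.FiberSumsC0 fun e => g e + h e := by
  obtain ⟨f, hf⟩ := hg
  obtain ⟨k, hk⟩ := hh
  exact ⟨f + k, fun v => (hf v).add (hk v)⟩

theorem FiberSumsC0.const_mul {g : E → ℝ} (hg : G.FiberSumsC0 g) (c : ℝ) :
    G.FiberSumsC0 fun e => c * g e := by
  obtain ⟨f, hf⟩ := hg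
  exact ⟨c • f, fun v => (hf v).mul_left c⟩

theorem FiberSumsC0.of_le [DiscreteTopology V] {g h : E → ℝ} (hg : G.FiberSumsC0 g)
    (h0 : ∀ e, 0 ≤ h e) (hle : ∀ e, h e ≤ g e) : G.FiberSumsC0 h := by
  obtain ⟨f, hf⟩ := hg
  have hs : ∀ v, Summable fun e : {e : E // G.r e = v} => h e := fun v =>
    (hf v).summable.of_nonneg_of_le (fun e => h0 e) (fun e => hle e)
  refine ⟨⟨⟨fun v => ∑' e : {e : E // G.r e = v}, h e, continuous_of_discreteTopology⟩, ?_⟩,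
    fun v => (hs v).hasSum⟩
  refine squeeze_zero (fun v => tsum_nonneg fun e => h0 e) (fun v => ?_) f.zero_at_infty'
  exact hasSum_le (f := fun e : {e : E // G.r e = v} => h e) (fun e => hle e) (hs v).hasSum (hf v)

variable (G)

/-- The vector space `X(E)` of all `ξ : E¹ → ℂ` such that `v ↦ ∑_{r(e) = v} |ξ(e)|²` is in
`C₀(E⁰)`. -/
def corrSubmodule [DiscreteTopology V] : Submodule ℂ (E → ℂ) where
  carrier := {ξ | G.FiberSumsC0 fun e => ‖ξ e‖ ^ 2}
  zero_mem' := ⟨0, fun v => by simp⟩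
  add_mem' {ξ η} hξ hη := by
    have hξ : G.FiberSumsC0 fun e => ‖ξ e‖ ^ 2 := hξ
    have hη : G.FiberSumsC0 fun e => ‖η e‖ ^ 2 := hη
    change G.FiberSumsC0 fun e => ‖(ξ + η) e‖ ^ 2
    refine ((hξ.add hη).const_mul 2).of_le (fun e => by positivity) fun e => ?_
    have h := norm_add_le (ξ e) (η e)
    simp only [Pi.add_apply]
    nlinarith [norm_nonneg (ξ e + η e), sq_nonneg (‖ξ e‖ - ‖η e‖)]
  smul_mem' c ξ hξ := by
    have hξ : G.FiberSumsC0 fun e => ‖ξ e‖ ^ 2 := hξ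
    have h := hξ.const_mul (‖c‖ ^ 2)
    change G.FiberSumsC0 fun e => ‖(c • ξ) e‖ ^ 2
    simpa only [Pi.smul_apply, smul_eq_mul, norm_mul, mul_pow] using h

theorem norm_apply_le_C0 (a : C₀(V, ℂ)) (v : V) : ‖a v‖ ≤ ‖a‖ :=
  a.toBCF.norm_coe_le_norm v

variable [DiscreteTopology V]

theorem mem_corrSubmodule {ξ : E → ℂ} :
    ξ ∈ G.corrSubmodule ↔ G.FiberSumsC0 fun e => ‖ξ e‖ ^ 2 := Iff.rfl

variable {G} in
theorem summable_inner {ξ η : E → ℂ} (hξ : ξ ∈ G.corrSubmodule) (hη : η ∈ G.corrSubmodule)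
    (v : V) : Summable fun e : {e : E // G.r e = v} => star (ξ e) * η e := by
  obtain ⟨f, hf⟩ := (G.mem_corrSubmodule.1 hξ).add (G.mem_corrSubmodule.1 hη)
  refine .of_norm_bounded (hf v).summable fun e => ?_
  rw [norm_mul, norm_star]
  nlinarith [sq_nonneg (‖ξ e‖ - ‖η e‖), sq_nonneg (‖ξ e‖ + ‖η e‖)]

/-- `⟨ξ, η⟩(v) = ∑_{r(e) = v} conj(ξ(e)) η(e)`, a function in `C₀(E⁰)`. -/
def corrInner (ξ η : G.corrSubmodule) : C₀(V, ℂ) where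
  toFun v := ∑' e : {e : E // G.r e = v}, star (ξ.1 e) * η.1 e
  continuous_toFun := continuous_of_discreteTopology
  zero_at_infty' := by
    obtain ⟨f, hf⟩ := (G.mem_corrSubmodule.1 ξ.2).add (G.mem_corrSubmodule.1 η.2)
    refine squeeze_zero_norm (fun v => ?_) f.zero_at_infty'
    refine tsum_of_norm_bounded (hf v) fun e => ?_
    rw [norm_mul, norm_star]
    nlinarith [sq_nonneg (‖ξ.1 e‖ - ‖η.1 e‖), sq_nonneg (‖ξ.1 e‖ + ‖η.1 e‖)]

theorem corrInner_apply (ξ η : G.corrSubmodule) (v : V) :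
    G.corrInner ξ η v = ∑' e : {e : E // G.r e = v}, star (ξ.1 e) * η.1 e := rfl

variable {G} in
theorem mul_mem {b : E → ℂ} {C : ℝ} (hb : ∀ e, ‖b e‖ ≤ C) {ξ : E → ℂ}
    (hξ : ξ ∈ G.corrSubmodule) : (fun e => b e * ξ e) ∈ G.corrSubmodule := by
  refine G.mem_corrSubmodule.2 ?_
  refine ((G.mem_corrSubmodule.1 hξ).const_mul (C ^ 2)).of_le (fun e => by positivity) fun e => ?_
  rw [norm_mul, mul_pow]
  gcongr
  exact hb e

/-- The algebraic structure of the graph correspondence: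
`(a · ξ)(e) = a(s(e)) ξ(e)`, `(ξ · a)(e) = ξ(e) a(r(e))` and
`⟨ξ, η⟩(v) = ∑_{r(e) = v} conj(ξ(e)) η(e)`. -/
def corrPre : PreCorrespondence C₀(V, ℂ) G.corrSubmodule where
  inner := LinearMap.mk₂'ₛₗ (starRingEnd ℂ) (RingHom.id ℂ) G.corrInner
    (fun ξ ξ' η => by
      ext v
      simp only [corrInner_apply, ZeroAtInftyContinuousMap.add_apply]
      rw [← (summable_inner ξ.2 η.2 v).tsum_add (summable_inner ξ'.2 η.2 v)]
      exact tsum_congr fun e => by simp [add_mul])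
    (fun c ξ η => by
      ext v
      simp only [corrInner_apply, ZeroAtInftyContinuousMap.smul_apply, smul_eq_mul]
      rw [← tsum_mul_left]
      exact tsum_congr fun e => by simp [mul_assoc])
    (fun ξ η η' => by
      ext v
      simp only [corrInner_apply, ZeroAtInftyContinuousMap.add_apply]
      rw [← (summable_inner ξ.2 η.2 v).tsum_add (summable_inner ξ.2 η'.2 v)]
      exact tsum_congr fun e => by simp [mul_add])
    (fun c ξ η => by
      ext v
      simp only [corrInner_apply, ZeroAtInftyContinuousMap.smul_apply, smul_eq_mul]
      rw [← tsum_mul_left]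
      exact tsum_congr fun e => by simp [mul_left_comm])
  ract := LinearMap.mk₂ ℂ
    (fun a ξ => ⟨fun e => a (G.r e) * ξ.1 e, mul_mem (fun _ => norm_apply_le_C0 a _) ξ.2⟩)
    (fun a b ξ => by ext e; simp [add_mul]) (fun c a ξ => by ext e; simp [mul_assoc])
    (fun a ξ η => by ext e; simp [mul_add]) (fun c a ξ => by ext e; simp [mul_left_comm])
  lact := LinearMap.mk₂ ℂ
    (fun a ξ => ⟨fun e => a (G.s e) * ξ.1 e, mul_mem (fun _ => norm_apply_le_C0 a _) ξ.2⟩)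
    (fun a b ξ => by ext e; simp [add_mul]) (fun c a ξ => by ext e; simp [mul_assoc])
    (fun a ξ η => by ext e; simp [mul_add]) (fun c a ξ => by ext e; simp [mul_left_comm])
  star_inner ξ η := by
    ext v
    change star (G.corrInner ξ η v) = G.corrInner η ξ v
    rw [corrInner_apply, corrInner_apply, tsum_star]
    exact tsum_congr fun e => by simp [mul_comm]
  inner_self_pos ξ := by
    obtain ⟨f, hf⟩ := ξ.2
    have h0 : ∀ v, 0 ≤ f v := fun v => (hf v).nonneg fun e => by positivity
    refine ⟨⟨⟨fun v => ((√(f v) : ℝ) : ℂ), continuous_of_discreteTopology⟩, ?_⟩, ?_⟩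
    · have h1 : Filter.Tendsto (fun v => ((√(f v) : ℝ) : ℂ)) (Filter.cocompact V)
          (nhds ((√0 : ℝ) : ℂ)) :=
        (Complex.continuous_ofReal.tendsto _).comp
          ((Real.continuous_sqrt.tendsto _).comp f.zero_at_infty')
      simpa using h1
    · ext v
      change G.corrInner ξ ξ v = star ((√(f v) : ℝ) : ℂ) * ((√(f v) : ℝ) : ℂ)
      rw [corrInner_apply]
      have h2 : star ((√(f v) : ℝ) : ℂ) * ((√(f v) : ℝ) : ℂ) = ((f v : ℝ) : ℂ) := by
        rw [RCLike.star_def, Complex.conj_ofReal, ← Complex.ofReal_mul,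
          Real.mul_self_sqrt (h0 v)]
      rw [h2]
      refine HasSum.tsum_eq ?_
      convert Complex.hasSum_ofReal.2 (hf v) using 2 with e
      rw [RCLike.star_def, Complex.conj_mul']
      push_cast
      rfl
  inner_ract ξ η a := by
    ext v
    change G.corrInner _ _ v = G.corrInner _ _ v * a v
    rw [corrInner_apply, corrInner_apply, ← tsum_mul_right]
    refine tsum_congr fun e => ?_
    obtain ⟨e, rfl⟩ := e
    simp [mul_comm, mul_left_comm, mul_assoc]
  ract_mul a b ξ := by ext e; simp [mul_assoc, mul_left_comm]
  lact_mul a b ξ := by ext e; simp [mul_assoc]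
  lact_ract a b ξ := by ext e; simp [mul_left_comm]
  inner_lact a ξ η := by
    ext v
    change G.corrInner _ _ v = G.corrInner _ _ v
    rw [corrInner_apply, corrInner_apply]
    exact tsum_congr fun e => by simp [mul_left_comm, mul_assoc]

theorem hasSum_corrInner (ξ : G.corrSubmodule) (v : V) :
    HasSum (fun e : {e : E // G.r e = v} => ‖ξ.1 e‖ ^ 2) ‖G.corrInner ξ ξ v‖ := by
  obtain ⟨f, hf⟩ := ξ.2
  convert hf v using 1
  have h : G.corrInner ξ ξ v = ((f v : ℝ) : ℂ) := by
    rw [corrInner_apply]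
    refine HasSum.tsum_eq ?_
    convert Complex.hasSum_ofReal.2 (hf v) using 2 with e
    rw [RCLike.star_def, Complex.conj_mul']
    push_cast
    rfl
  rw [h, Complex.norm_real, Real.norm_of_nonneg ((hf v).nonneg fun e => by positivity)]

theorem corrPre_definite (ξ : G.corrSubmodule) (h : G.corrPre.inner ξ ξ = 0) : ξ = 0 := by
  ext e
  have h1 := G.hasSum_corrInner ξ (G.r e)
  rw [show G.corrInner ξ ξ = 0 from h, ZeroAtInftyContinuousMap.zero_apply, norm_zero] at h1
  have h2 := congrFun ((hasSum_zero_iff_of_nonneg fun e => by positivity).1 h1) ⟨e, rfl⟩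
  simpa using h2

theorem sum_sq_le (x : G.corrSubmodule) (v : V) (F : Finset {e : E // G.r e = v}) :
    ∑ e ∈ F, ‖x.1 e‖ ^ 2 ≤ G.corrPre.nrm x ^ 2 := by
  rw [PreCorrespondence.nrm_sq]
  exact (sum_le_hasSum F (fun e _ => by positivity) (G.hasSum_corrInner x v)).trans
    (norm_apply_le_C0 _ v)

theorem nrm_le_of_sum_le (x : G.corrSubmodule) {C : ℝ} (hC : 0 ≤ C)
    (h : ∀ v (F : Finset {e : E // G.r e = v}), ∑ e ∈ F, ‖x.1 e‖ ^ 2 ≤ C ^ 2) :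
    G.corrPre.nrm x ≤ C := by
  refine Real.sqrt_le_iff.2 ⟨hC, ?_⟩
  rw [← ZeroAtInftyContinuousMap.norm_toBCF_eq_norm]
  refine (BoundedContinuousFunction.norm_le (sq_nonneg C)).2 fun v => ?_
  exact hasSum_le_of_sum_le (G.hasSum_corrInner x v) (h v)

theorem corr_complete : CompleteSpace G.corrPre.Space := by
  refine Metric.complete_of_cauchySeq_tendsto fun u hu => ?_
  let x : ℕ → G.corrSubmodule := u
  have hx : ∀ ε > 0, ∃ N, ∀ n ≥ N, ∀ m ≥ N, G.corrPre.nrm (x n - x m) ≤ ε := by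
    intro ε hε
    obtain ⟨N, hN⟩ := Metric.cauchySeq_iff.1 hu ε hε
    refine ⟨N, fun n hn m hm => ?_⟩
    have h := (hN n hn m hm).le
    rwa [dist_eq_norm] at h
  have hpt : ∀ e, ∃ z, Filter.Tendsto (fun n => (x n).1 e) Filter.atTop (nhds z) := by
    intro e
    refine cauchySeq_tendsto_of_complete (Metric.cauchySeq_iff.2 fun ε hε => ?_)
    obtain ⟨N, hN⟩ := hx (ε / 2) (half_pos hε)
    refine ⟨N, fun n hn m hm => ?_⟩
    have h1 := G.sum_sq_le (x n - x m) (G.r e) {⟨e, rfl⟩}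
    rw [Finset.sum_singleton] at h1
    have h2 := ((abs_le_of_sq_le_sq h1 (Real.sqrt_nonneg _)).trans' (le_abs_self _)).trans (hN n hn m hm)
    rw [dist_eq_norm]
    exact h2.trans_lt (half_lt_self hε)
  choose ξ hξ using hpt
  have hlim : ∀ ε > 0, ∃ N, ∀ n ≥ N, ∀ v (F : Finset {e : E // G.r e = v}),
      ∑ e ∈ F, ‖(x n).1 e - ξ e‖ ^ 2 ≤ ε ^ 2 := by
    intro ε hε
    obtain ⟨N, hN⟩ := hx ε hε
    refine ⟨N, fun n hn v F => ?_⟩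
    have ht : Filter.Tendsto (fun m => ∑ e ∈ F, ‖(x n).1 e - (x m).1 e‖ ^ 2) Filter.atTop
        (nhds (∑ e ∈ F, ‖(x n).1 e - ξ e‖ ^ 2)) :=
      tendsto_finsetSum _ fun e _ => ((tendsto_const_nhds.sub (hξ e)).norm).pow 2
    refine le_of_tendsto ht (Filter.eventually_atTop.2 ⟨N, fun m hm => ?_⟩)
    exact (G.sum_sq_le (x n - x m) v F).trans
      (pow_le_pow_left₀ (Real.sqrt_nonneg _) (hN n hn m hm) 2)
  have hle : ∀ n e, ‖ξ e‖ ^ 2 ≤ 2 * ‖(x n).1 e‖ ^ 2 + 2 * ‖(x n).1 e - ξ e‖ ^ 2 := by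
    intro n e
    have h := norm_sub_le ((x n).1 e) ((x n).1 e - ξ e)
    rw [sub_sub_cancel] at h
    nlinarith [norm_nonneg (ξ e), sq_nonneg (‖(x n).1 e‖ - ‖(x n).1 e - ξ e‖)]
  have hsd : ∀ n v, (∀ F : Finset {e : E // G.r e = v}, ∑ e ∈ F, ‖(x n).1 e - ξ e‖ ^ 2 ≤ 1 ^ 2) →
      Summable fun e : {e : E // G.r e = v} => ‖(x n).1 e - ξ e‖ ^ 2 := fun n v h =>
    summable_of_sum_le (fun e => by positivity) h
  have hmem : ξ ∈ G.corrSubmodule := by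
    have hs : ∀ v, Summable fun e : {e : E // G.r e = v} => ‖ξ e‖ ^ 2 := by
      intro v
      obtain ⟨N, hN⟩ := hlim 1 one_pos
      exact .of_nonneg_of_le (fun e => by positivity) (fun e => hle N e)
        (((G.hasSum_corrInner (x N) v).summable.mul_left 2).add
          ((hsd N v (hN N le_rfl v)).mul_left 2))
    refine ⟨⟨⟨fun v => ∑' e : {e : E // G.r e = v}, ‖ξ e‖ ^ 2, continuous_of_discreteTopology⟩,
      ?_⟩, fun v => (hs v).hasSum⟩
    refine Metric.tendsto_nhds.2 fun ε hε => ?_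
    obtain ⟨N, hN⟩ := hlim (√(ε / 4)) (Real.sqrt_pos.2 (by positivity))
    have h0 := (Metric.tendsto_nhds.1 (G.corrInner (x N) (x N)).zero_at_infty') (ε / 4)
      (by positivity)
    filter_upwards [h0] with v hv
    rw [dist_zero_right] at hv
    rw [dist_zero_right]
    change ‖∑' e : {e : E // G.r e = v}, ‖ξ e‖ ^ 2‖ < ε
    rw [Real.norm_of_nonneg (tsum_nonneg fun e => by positivity)]
    have hd := summable_of_sum_le (f := fun e : {e : E // G.r e = v} => ‖(x N).1 e - ξ e‖ ^ 2)
      (fun e => by positivity) (hN N le_rfl v)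
    have h1 := hasSum_le (f := fun e : {e : E // G.r e = v} => ‖ξ e‖ ^ 2)
      (fun e => hle N e) (hs v).hasSum
      (((G.hasSum_corrInner (x N) v).mul_left 2).add (hd.hasSum.mul_left 2))
    have h2 := hasSum_le_of_sum_le hd.hasSum (hN N le_rfl v)
    rw [Real.sq_sqrt (by positivity)] at h2
    have h3 : ‖G.corrInner (x N) (x N) v‖ < ε / 4 := hv
    linarith
  let y : G.corrSubmodule := ⟨ξ, hmem⟩
  let y' : G.corrPre.Space := y
  refine ⟨y', Metric.tendsto_atTop.2 fun ε hε => ?_⟩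
  obtain ⟨N, hN⟩ := hlim (ε / 2) (half_pos hε)
  refine ⟨N, fun n hn => ?_⟩
  rw [dist_eq_norm]
  have h := G.nrm_le_of_sum_le (x n - y) (half_pos hε).le (hN n hn)
  exact lt_of_le_of_lt h (half_lt_self hε)

/-- The graph correspondence `X(E)` over `C₀(E⁰)`, where `E⁰` carries the discrete topology. -/
def correspondence : CStarCorrespondence C₀(V, ℂ) :=
  G.corrPre.toCStar G.corrPre_definite G.corr_complete

end Correspondence

/-- A path `e₁ ⋯ eₙ` with `n ≥ 1`: a nonempty finite sequence of edges with
`r(eᵢ) = s(eᵢ₊₁)`. -/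
structure Path where
  edges : List E
  ne_nil : edges ≠ []
  chain : edges.IsChain fun e f => G.r e = G.s f

namespace Path

variable {G}

/-- `s(e₁ ⋯ eₙ) = s(e₁)` -/
def source (α : G.Path) : V := G.s (α.edges.head α.ne_nil)

/-- `r(e₁ ⋯ eₙ) = r(eₙ)` -/
def range (α : G.Path) : V := G.r (α.edges.getLast α.ne_nil)

/-- A cycle is a path with `s(e₁) = r(eₙ)`. -/
def IsCycle (α : G.Path) : Prop := α.source = α.range

/-- An exit for `e₁ ⋯ eₙ` is an edge `f` with `s(f) = s(eᵢ)` and `f ≠ eᵢ` for some `i`. -/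
def IsExit (α : G.Path) (f : E) : Prop := ∃ e ∈ α.edges, G.s f = G.s e ∧ f ≠ e

end Path

/-- For all vertices `v`, `w` there is a path from `v` to `w`; a single vertex counts as a path of
length zero. -/
def StronglyConnected : Prop :=
  ∀ v w : V, v = w ∨ ∃ α : G.Path, α.source = v ∧ α.range = w

/-- Every cycle has an exit. -/
def ConditionL : Prop :=
  ∀ α : G.Path, α.IsCycle → ∃ f, α.IsExit f

/-- The graph is a simple cycle: for some `k = n + 1 ≥ 1` it has exactly `k` distinct vertices
`v₀, …, vₙ` and exactly `k` distinct edges `e₀, …, eₙ`, where `eᵢ` goes from `vᵢ` to `vᵢ₊₁`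
(indices modulo `k`). -/
def IsSimpleCycle : Prop :=
  ∃ (n : ℕ) (v : Fin (n + 1) ≃ V) (e : Fin (n + 1) ≃ E),
    ∀ i, G.s (e i) = v i ∧ G.r (e i) = v (i + 1)

end DirectedGraph

end

/-!
If `r` and `s` are bijective, then `ξ ↦ ξ ∘ r⁻¹` identifies `X(E)` with `A` twisted by the
automorphism of `A` that the permutation `r ∘ s⁻¹` of the vertices induces. The `n`-th tensor power
is then twisted by the `n`-th power of that automorphism, so for a simple cycle with `n` vertices
it is `A` itself.

Conversely, an isomorphism `X^{⊗ n} ≅ A` with `A` commutative gives `⟨x, a · y⟩ = a ⟨x, y⟩` and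
`⟨x, y⟩ ⟨y, x⟩ = ⟨x, x⟩ ⟨y, y⟩`. Applied to elementary tensors `δ_{e₁} ⊗ ⋯ ⊗ δ_{eₙ}` along paths,
the first identity says that every path of length `n` is a cycle, and the second that such paths
with distinct first edges have distinct sources. Moreover the left action on `X^{⊗ n}` is faithful,
so every vertex emits an edge: there is a cycle, and it has no exit.

Strong connectivity only enters through the graph-theoretic fact that a cycle without exit is then
the whole graph.
-/

noncomputable section

universe u w w'

namespace CStarCorrespondence

variable {A : Type u} [NonUnitalCStarAlgebra A]
  (X : CStarCorrespondence.{u, w} A) (Y : CStarCorrespondence.{u, w'} A)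

section HilbertModule

variable {X}

theorem norm_eq_nrm (x : X.Carrier) : ‖x‖ = X.toPre.nrm x :=
  (Real.sqrt_sq (norm_nonneg x)).symm.trans (congrArg Real.sqrt (X.norm_sq_eq x))

theorem norm_inner_le (x y : X.Carrier) : ‖X.toPre.inner x y‖ ≤ ‖x‖ * ‖y‖ := by
  simpa only [norm_eq_nrm] using X.toPre.norm_inner_le x y

theorem norm_lact_le (a : A) (x : X.Carrier) : ‖X.toPre.lact a x‖ ≤ ‖a‖ * ‖x‖ := by
  simpa only [norm_eq_nrm] using X.toPre.nrm_lact_le a x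

theorem continuous_inner {T : Type*} [TopologicalSpace T] {f g : T → X.Carrier}
    (hf : Continuous f) (hg : Continuous g) :
    Continuous fun t => X.toPre.inner (f t) (g t) :=
  ((X.toPre.inner.mkContinuous₂ 1 fun x y => by
    rw [one_mul]; exact norm_inner_le x y).continuous.comp hf).clm_apply hg

theorem continuous_lact (a : A) : Continuous (X.toPre.lact a) :=
  ((X.toPre.lact a).mkContinuous ‖a‖ (norm_lact_le a)).continuous

theorem eq_of_inner_right_eq {x y : X.Carrier}
    (h : ∀ z, X.toPre.inner z x = X.toPre.inner z y) : x = y := by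
  have hinner : X.toPre.inner (x - y) (x - y) = 0 := by rw [map_sub, h, sub_self]
  have hnorm : ‖x - y‖ ^ 2 = 0 := by rw [X.norm_sq_eq, hinner, norm_zero]
  exact sub_eq_zero.1 (norm_eq_zero.1 (pow_eq_zero_iff two_ne_zero |>.1 hnorm))

end HilbertModule

section Isomorphism

variable {X Y}

theorem IsIsomorphic.exists_linearEquiv (h : X.IsIsomorphic Y) :
    ∃ Φ : X.Carrier ≃ₗ[ℂ] Y.Carrier,
      (∀ a x, Φ (X.toPre.lact a x) = Y.toPre.lact a (Φ x)) ∧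
      ∀ x x', Y.toPre.inner (Φ x) (Φ x') = X.toPre.inner x x' := by
  obtain ⟨Φ, hΦ, hlact, hinner⟩ := h
  -- `Φ` preserves inner products and is onto, so its linearity can be tested against its range.
  have hext {y y' : Y.Carrier}
      (h : ∀ x, Y.toPre.inner (Φ x) y = Y.toPre.inner (Φ x) y') : y = y' :=
    eq_of_inner_right_eq (hΦ.surjective.forall.2 h)
  let Φₗ : X.Carrier →ₗ[ℂ] Y.Carrier :=
    { toFun := Φ
      map_add' := fun x x' => hext fun z => by simp only [map_add, hinner]
      map_smul' := fun c x => hext fun z => by simp only [map_smul, hinner, RingHom.id_apply] }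
  exact ⟨.ofBijective Φₗ hΦ, hlact, hinner⟩

theorem _root_.PreCorrespondence.completion_isIsomorphic {M : Type w} [AddCommGroup M]
    [Module ℂ M] (P : PreCorrespondence A M) (f : M →ₗ[ℂ] Y.Carrier) (hf : DenseRange f)
    (hlact : ∀ a x, f (P.lact a x) = Y.toPre.lact a (f x))
    (hinner : ∀ x x', Y.toPre.inner (f x) (f x') = P.inner x x') :
    P.completion.IsIsomorphic Y := by
  have hnorm (x : P.Space) : ‖f x‖ = ‖x‖ :=
    (norm_eq_nrm _).trans (congrArg (fun a => √‖a‖) (hinner x x))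
  let f' : P.Space →ₗᵢ[ℂ] Y.Carrier := ⟨f, hnorm⟩
  let g : UniformSpace.Completion P.Space → Y.Carrier := UniformSpace.Completion.extension f'
  have hg (x : P.Space) : g x = f x :=
    UniformSpace.Completion.extension_coe f'.isometry.uniformContinuous x
  have hgi : Isometry g := f'.isometry.completion_extension
  have hrange : DenseRange g := hf.mono <| Set.range_subset_iff.2 fun x => ⟨_, hg x⟩
  have hsurj : Function.Surjective g :=
    Set.range_eq_univ.1 (hgi.isClosedEmbedding.isClosed_range.closure_eq ▸ hrange.closure_eq)
  refine ⟨g, ⟨hgi.injective, hsurj⟩, fun a x => ?_, fun x x' => ?_⟩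
  · change g (PreCorrespondence.complAct P.norm_lact_space_le a x) = _
    induction x using UniformSpace.Completion.induction_on with
    | hp =>
      exact isClosed_eq (hgi.continuous.comp (PreCorrespondence.continuous_complAct _ a))
        ((continuous_lact a).comp hgi.continuous)
    | ih x => rw [PreCorrespondence.complAct_coe, hg, hg]; exact hlact a x
  · change _ = P.complInner x x'
    induction x, x' using UniformSpace.Completion.induction_on₂ with
    | hp =>
      exact isClosed_eq
        (continuous_inner (hgi.continuous.comp continuous_fst) (hgi.continuous.comp continuous_snd))
        (P.continuous_complInner_comp continuous_fst continuous_snd)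
    | ih x x' => rw [hg, hg, P.complInner_coe]; exact hinner x x'

theorem isIsomorphic_self_iff : X.IsIsomorphic (self A) ↔
    ∃ Φ : X.Carrier → A, Function.Bijective Φ ∧
      (∀ a x, Φ (X.toPre.lact a x) = a * Φ x) ∧
      ∀ x x', star (Φ x) * Φ x' = X.toPre.inner x x' :=
  Iff.rfl

theorem IsIsomorphic.eq_zero_of_lact_eq_zero (h : X.IsIsomorphic (self A)) {a : A}
    (ha : X.toPre.lact a = 0) : a = 0 := by
  obtain ⟨Φ, hΦ, hlact, hinner⟩ := isIsomorphic_self_iff.1 h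
  obtain ⟨x, hx⟩ := hΦ.surjective (star a)
  obtain ⟨y, hy⟩ := hΦ.surjective (a * star a)
  have hzero : star (a * star a) * (a * star a) = 0 := calc
    _ = star (Φ y) * (a * Φ x) := by rw [hx, hy]
    _ = X.toPre.inner y (X.toPre.lact a x) := by rw [← hinner, hlact]
    _ = 0 := by rw [ha, LinearMap.zero_apply, map_zero]
  rwa [CStarRing.star_mul_self_eq_zero_iff, CStarRing.mul_star_self_eq_zero_iff] at hzero

end Isomorphism

section Commutative

variable {A : Type u} [NonUnitalCommCStarAlgebra A] {X : CStarCorrespondence.{u, w} A}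

theorem IsIsomorphic.inner_lact_eq_mul (h : X.IsIsomorphic (self A)) (a : A) (x y : X.Carrier) :
    X.toPre.inner x (X.toPre.lact a y) = a * X.toPre.inner x y := by
  obtain ⟨Φ, -, hlact, hinner⟩ := isIsomorphic_self_iff.1 h
  rw [← hinner, ← hinner, hlact, mul_left_comm]

theorem IsIsomorphic.inner_mul_inner_comm (h : X.IsIsomorphic (self A)) (x y : X.Carrier) :
    X.toPre.inner x y * X.toPre.inner y x = X.toPre.inner x x * X.toPre.inner y y := by
  obtain ⟨Φ, -, -, hinner⟩ := isIsomorphic_self_iff.1 h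
  simp only [← hinner]
  ac_rfl

end Commutative

section TensorProduct

/-- The class of the elementary tensor `x ⊗ y` in `X ⊗_A Y`. -/
def tmul (x : X.Carrier) (y : Y.Carrier) : (X.tensor Y).Carrier :=
  UniformSpace.Completion.coe' (α := (X.toPre.tensor Y.toPre).Space) (x ⊗ₜ[ℂ] y)

theorem inner_tmul (x x' : X.Carrier) (y y' : Y.Carrier) :
    (X.tensor Y).toPre.inner (X.tmul Y x y) (X.tmul Y x' y')
      = Y.toPre.inner y (Y.toPre.lact (X.toPre.inner x x') y') :=
  (X.toPre.tensor Y.toPre).complInner_coe _ _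

theorem lact_tmul (a : A) (x : X.Carrier) (y : Y.Carrier) :
    (X.tensor Y).toPre.lact a (X.tmul Y x y) = X.tmul Y (X.toPre.lact a x) y :=
  PreCorrespondence.complAct_coe (X.toPre.tensor Y.toPre).norm_lact_space_le a _

theorem smul_tmul (c : ℂ) (x : X.Carrier) (y : Y.Carrier) :
    X.tmul Y (c • x) y = c • X.tmul Y x y :=
  UniformSpace.Completion.coe_smul (X := (X.toPre.tensor Y.toPre).Space) c (x ⊗ₜ[ℂ] y)

variable {X}

theorem lact_tensor_eq_zero {a : A} (ha : X.toPre.lact a = 0) :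
    (X.tensor Y).toPre.lact a = 0 := by
  have hspace (t : X.Carrier ⊗[ℂ] Y.Carrier) : (X.toPre.tensor Y.toPre).lact a t = 0 := by
    change LinearMap.rTensor Y.Carrier (X.toPre.lact a) t = 0
    rw [ha, LinearMap.rTensor_zero, LinearMap.zero_apply]
  refine LinearMap.ext fun t => ?_
  change UniformSpace.Completion (X.toPre.tensor Y.toPre).Space at t
  induction t using UniformSpace.Completion.induction_on with
  | hp => exact isClosed_eq (continuous_lact a) continuous_const
  | ih t =>
    refine (PreCorrespondence.complAct_coe _ a t).trans ?_
    exact (congrArg _ (hspace t)).trans UniformSpace.Completion.coe_zero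

theorem lact_tensorPowSucc_eq_zero {a : A} (ha : X.toPre.lact a = 0) :
    ∀ n, (X.tensorPowSucc n).toPre.lact a = 0
  | 0 => ha
  | n + 1 => lact_tensor_eq_zero (X.tensorPowSucc n) ha

end TensorProduct

section Twisted

/-- The identity correspondence `A` with its left action twisted by an automorphism `φ`, that is,
`a · b = φ(a) b`. -/
def twistedSelf (φ : A ≃⋆ₐ[ℂ] A) : CStarCorrespondence.{u, u} A where
  Carrier := A
  toPre :=
    { (self A).toPre with
      lact := LinearMap.mul ℂ A ∘ₗ (φ : A →ₗ[ℂ] A)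
      lact_mul := fun a b x => by simp [mul_assoc]
      lact_ract := fun a b x => (mul_assoc (φ a) x b).symm
      inner_lact := fun a x y => by
        change star (φ a * x) * y = star x * (φ (star a) * y)
        rw [star_mul, map_star, mul_assoc] }
  norm_sq_eq := (self A).norm_sq_eq

theorem twistedSelf_one : twistedSelf (1 : A ≃⋆ₐ[ℂ] A) = self A := rfl

theorem denseRange_mul : DenseRange fun p : A × A => p.1 * p.2 := by
  let _ := CStarAlgebra.spectralOrder A
  have _ := CStarAlgebra.spectralOrderedRing A
  exact fun a => mem_closure_of_tendsto
    ((CStarAlgebra.increasingApproximateUnit A).tendsto_mul_left a)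
    (.of_forall fun b => ⟨(a, b), rfl⟩)

variable {X Y}

theorem IsIsomorphic.exists_linearEquiv_twistedSelf {φ : A ≃⋆ₐ[ℂ] A}
    (hX : X.IsIsomorphic (twistedSelf φ)) :
    ∃ Φ : X.Carrier ≃ₗ[ℂ] A, (∀ a x, Φ (X.toPre.lact a x) = φ a * Φ x) ∧
      ∀ x x', star (Φ x) * Φ x' = X.toPre.inner x x' :=
  hX.exists_linearEquiv

theorem IsIsomorphic.tensor_twistedSelf {φ ψ : A ≃⋆ₐ[ℂ] A} (hX : X.IsIsomorphic (twistedSelf φ))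
    (hY : Y.IsIsomorphic (twistedSelf ψ)) :
    (X.tensor Y).IsIsomorphic (twistedSelf (ψ * φ)) := by
  obtain ⟨Φ, hΦlact, hΦinner⟩ := hX.exists_linearEquiv_twistedSelf
  obtain ⟨Ψ, hΨlact, hΨinner⟩ := hY.exists_linearEquiv_twistedSelf
  -- `x ⊗ y ↦ ψ(Φ x) Ψ y` is the identification of `A_φ ⊗ A_ψ` with `A_{ψ ∘ φ}`.
  let f : X.Carrier ⊗[ℂ] Y.Carrier →ₗ[ℂ] A := TensorProduct.lift <|
    (LinearMap.mul ℂ A).compl₁₂ ((ψ : A →ₗ[ℂ] A) ∘ₗ Φ.toLinearMap) Ψ.toLinearMap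
  have hf (x : X.Carrier) (y : Y.Carrier) : f (x ⊗ₜ y) = ψ (Φ x) * Ψ y := rfl
  have hrange : DenseRange f := by
    refine denseRange_mul.mono ?_
    rintro _ ⟨⟨a, b⟩, rfl⟩
    exact ⟨Φ.symm (ψ.symm a) ⊗ₜ Ψ.symm b, by simp [hf]⟩
  have hlact (a : A) (t : X.Carrier ⊗[ℂ] Y.Carrier) :
      f ((X.toPre.tensor Y.toPre).lact a t) = ψ (φ a) * f t := by
    induction t with
    | zero => simp only [map_zero, mul_zero]
    | add t t' ht ht' => simp only [map_add, mul_add, ht, ht']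
    | tmul x y =>
      change f (X.toPre.lact a x ⊗ₜ y) = _
      rw [hf, hf, hΦlact, map_mul, mul_assoc]
  have hinner (t t' : X.Carrier ⊗[ℂ] Y.Carrier) :
      star (f t) * f t' = PreCorrespondence.tensorInner X.toPre Y.toPre t t' := by
    induction t with
    | zero => simp
    | add t₁ t₂ h₁ h₂ => simp only [map_add, star_add, add_mul, h₁, h₂, LinearMap.add_apply]
    | tmul x y =>
      induction t' with
      | zero => simp
      | add t₁ t₂ h₁ h₂ => simp only [map_add, mul_add, h₁, h₂]
      | tmul x' y' =>
        rw [hf, hf, PreCorrespondence.tensorInner_tmul, ← hΨinner, hΨlact, ← hΦinner]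
        simp only [star_mul, map_mul, map_star, mul_assoc]
  exact (X.toPre.tensor Y.toPre).completion_isIsomorphic (Y := twistedSelf (ψ * φ)) f
    hrange hlact hinner

theorem IsIsomorphic.tensorPowSucc_twistedSelf {φ : A ≃⋆ₐ[ℂ] A}
    (hX : X.IsIsomorphic (twistedSelf φ)) :
    ∀ n, (X.tensorPowSucc n).IsIsomorphic (twistedSelf (φ ^ (n + 1)))
  | 0 => by rwa [zero_add, pow_one]
  | n + 1 => by
    rw [pow_succ]
    exact hX.tensor_twistedSelf (hX.tensorPowSucc_twistedSelf n)

theorem IsIsomorphic.not_nonperiodic_of_isOfFinOrder {φ : A ≃⋆ₐ[ℂ] A}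
    (hX : X.IsIsomorphic (twistedSelf φ)) (hφ : IsOfFinOrder φ) : ¬ X.Nonperiodic := by
  obtain ⟨_ | n, hn, hpow⟩ := isOfFinOrder_iff_pow_eq_one.1 hφ
  · exact absurd hn (lt_irrefl 0)
  intro hnonper
  have hself : (X.tensorPowSucc n).IsIsomorphic (self A) := by
    rw [← twistedSelf_one, ← hpow]
    exact hX.tensorPowSucc_twistedSelf n
  exact n.succ_ne_zero (hnonper (n + 1) hself)

end Twisted

end CStarCorrespondence

section DiscreteSpace

variable {V : Type*} [TopologicalSpace V] [DiscreteTopology V]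

open Classical in
/-- The point mass at a point `v` of a discrete space: the function in `C₀(V)` with value `1` at `v`
and `0` elsewhere. -/
def pointMass {R : Type*} [TopologicalSpace R] [MulZeroOneClass R] (v : V) : C₀(V, R) where
  toFun := Pi.single v 1
  continuous_toFun := continuous_of_discreteTopology
  zero_at_infty' := by
    rw [Filter.cocompact_eq_cofinite]
    refine tendsto_const_nhds.congr' ?_
    filter_upwards [(Set.finite_singleton v).compl_mem_cofinite] with w hw
    exact (Pi.single_eq_of_ne (M := fun _ => R) hw 1).symm

section PointMass

variable {R : Type*} [TopologicalSpace R] [MulZeroOneClass R]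

theorem pointMass_self (v : V) : pointMass v v = (1 : R) := by
  classical exact Pi.single_eq_same v 1

theorem pointMass_of_ne {v w : V} (h : w ≠ v) : pointMass v w = (0 : R) := by
  classical exact Pi.single_eq_of_ne h 1

theorem pointMass_ne_zero [Nontrivial R] (v : V) : (pointMass v : C₀(V, R)) ≠ 0 := fun h =>
  zero_ne_one (α := R) ((DFunLike.congr_fun h v).symm.trans (pointMass_self v))

end PointMass

/-- The action of the permutations of a discrete space `V` by automorphisms of `C₀(V)`, where `σ`
takes `a` to `a ∘ σ⁻¹`. -/
def permAut : Equiv.Perm V →* (C₀(V, ℂ) ≃⋆ₐ[ℂ] C₀(V, ℂ)) where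
  toFun σ :=
    { toFun := fun a => a.comp (Homeomorph.toCocompactMap (σ.symm.toHomeomorphOfDiscrete))
      invFun := fun a => a.comp (Homeomorph.toCocompactMap (σ.toHomeomorphOfDiscrete))
      left_inv := fun a => DFunLike.ext _ _ fun v => congrArg a (σ.symm_apply_apply v)
      right_inv := fun a => DFunLike.ext _ _ fun v => congrArg a (σ.apply_symm_apply v)
      map_mul' := fun _ _ => rfl
      map_add' := fun _ _ => rfl
      map_star' := fun _ => rfl
      map_smul' := fun _ _ => rfl }
  map_one' := rfl
  map_mul' _ _ := rfl

end DiscreteSpace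

theorem exists_equiv_fin_of_mem_periodicPts {α : Type*} {f : α → α} {x : α}
    (hx : x ∈ Function.periodicPts f) (horbit : ∀ y, ∃ i, f^[i] x = y) :
    ∃ (n : ℕ) (e : Fin (n + 1) ≃ α), ∀ i, f (e i) = e (i + 1) := by
  obtain ⟨n, hn⟩ : ∃ n, Function.minimalPeriod f x = n + 1 :=
    Nat.exists_eq_add_one.2 (Function.minimalPeriod_pos_of_mem_periodicPts hx)
  have hmod (i : ℕ) : f^[i % (n + 1)] x = f^[i] x := by
    rw [← hn, Function.iterate_mod_minimalPeriod_eq]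
  have hinj : Function.Injective fun i : Fin (n + 1) => f^[i] x := fun i j hij =>
    Fin.ext <| (Function.iterate_eq_iterate_iff_of_lt_minimalPeriod
      (i.isLt.trans_eq hn.symm) (j.isLt.trans_eq hn.symm)).1 hij
  have hsurj : Function.Surjective fun i : Fin (n + 1) => f^[i] x := fun y => by
    obtain ⟨i, rfl⟩ := horbit y
    exact ⟨⟨i % (n + 1), Nat.mod_lt i n.succ_pos⟩, hmod i⟩
  refine ⟨n, .ofBijective _ ⟨hinj, hsurj⟩, fun i => ?_⟩
  change f (f^[i] x) = f^[(i + 1 : Fin (n + 1))] x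
  rw [Fin.val_add, Fin.val_one', Nat.add_mod_mod, hmod, Function.iterate_succ_apply']

namespace DirectedGraph

section BijectiveRange

variable {V E : Type*} {G : DirectedGraph V E}

theorem hasSum_fiber_of_bijective {F : Type*} [AddCommMonoid F] [TopologicalSpace F]
    (hr : Function.Bijective G.r) (g : E → F) (v : V) :
    HasSum (fun e : {e : E // G.r e = v} => g e) (g ((Equiv.ofBijective G.r hr).symm v)) := by
  have hv : G.r ((Equiv.ofBijective G.r hr).symm v) = v := Equiv.ofBijective_apply_symm_apply ..
  let _ : Unique {e : E // G.r e = v} :=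
    { default := ⟨_, hv⟩
      uniq := fun e => Subtype.ext (hr.injective (e.2.trans hv.symm)) }
  exact hasSum_unique _

variable [TopologicalSpace V] [DiscreteTopology V]

theorem mem_corrSubmodule_iff_of_bijective (hr : Function.Bijective G.r) {ξ : E → ℂ} :
    ξ ∈ G.corrSubmodule ↔
      Filter.Tendsto (ξ ∘ (Equiv.ofBijective G.r hr).symm) (Filter.cocompact V) (nhds 0) := by
  have hsum := hasSum_fiber_of_bijective hr fun e => ‖ξ e‖ ^ 2
  rw [tendsto_zero_iff_norm_tendsto_zero]
  constructor
  · rintro ⟨f, hf⟩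
    have hsqrt : Filter.Tendsto (fun v => √(f v)) (Filter.cocompact V) (nhds 0) :=
      Real.sqrt_zero ▸ f.zero_at_infty'.sqrt
    refine hsqrt.congr fun v => ?_
    rw [(hf v).unique (hsum v), Real.sqrt_sq (norm_nonneg _), Function.comp_apply]
  · intro h
    refine ⟨⟨⟨fun v => ‖ξ ((Equiv.ofBijective G.r hr).symm v)‖ ^ 2,
      continuous_of_discreteTopology⟩, ?_⟩, hsum⟩
    simpa using h.pow 2

theorem correspondence_isIsomorphic_twistedSelf (hr : Function.Bijective G.r)
    (hs : Function.Bijective G.s) :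
    G.correspondence.IsIsomorphic (CStarCorrespondence.twistedSelf
      (permAut ((Equiv.ofBijective G.s hs).symm.trans (.ofBijective G.r hr)))) := by
  let ρ := Equiv.ofBijective G.r hr
  let Φ (ξ : G.corrSubmodule) : C₀(V, ℂ) :=
    { toFun := ξ.1 ∘ ρ.symm
      continuous_toFun := continuous_of_discreteTopology
      zero_at_infty' := (mem_corrSubmodule_iff_of_bijective hr).1 ξ.2 }
  have hinj : Function.Injective Φ := fun ξ η h =>
    Subtype.ext (ρ.symm.surjective.injective_comp_right (congrArg DFunLike.coe h))
  have hsurj : Function.Surjective Φ := fun a =>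
    ⟨⟨a ∘ ρ, (mem_corrSubmodule_iff_of_bijective hr).2 <| by
      rw [Function.comp_assoc, ρ.self_comp_symm]
      exact a.zero_at_infty'⟩, DFunLike.ext _ _ fun v => congrArg a (ρ.apply_symm_apply v)⟩
  refine ⟨Φ, ⟨hinj, hsurj⟩, fun a ξ => rfl, fun ξ η => ?_⟩
  ext v
  exact ((hasSum_fiber_of_bijective hr (fun e => star (ξ.1 e) * η.1 e) v).tsum_eq).symm

theorem not_nonperiodic_of_bijective [Finite V] (hr : Function.Bijective G.r)
    (hs : Function.Bijective G.s) : ¬ G.correspondence.Nonperiodic :=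
  (correspondence_isIsomorphic_twistedSelf hr hs).not_nonperiodic_of_isOfFinOrder
    (permAut.isOfFinOrder (isOfFinOrder_of_finite _))

theorem IsSimpleCycle.not_nonperiodic (h : G.IsSimpleCycle) : ¬ G.correspondence.Nonperiodic := by
  obtain ⟨n, v, e, hve⟩ := h
  have _ : Finite V := .of_equiv _ v
  have hs : G.s = v ∘ e.symm := by
    ext f
    simpa using (hve (e.symm f)).1
  have hr : G.r = (e.symm.trans (Equiv.addRight 1)).trans v := by
    ext f
    simpa using (hve (e.symm f)).2
  exact not_nonperiodic_of_bijective (hr ▸ Equiv.bijective _)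
    (hs ▸ (e.symm.trans v).bijective)

end BijectiveRange

section ElementaryTensors

variable {V E : Type*} [TopologicalSpace V] [DiscreteTopology V] (G : DirectedGraph V E)

theorem hasSum_fiber_of_support {R : Type*} [TopologicalSpace R] [NonAssocSemiring R] {e : E}
    {g : E → R} (hg : ∀ f, f ≠ e → g f = 0) (v : V) :
    HasSum (fun f : {f : E // G.r f = v} => g f) (g e * pointMass (G.r e) v) := by
  obtain rfl | hv := eq_or_ne v (G.r e)
  · rw [pointMass_self, mul_one]
    exact hasSum_single (⟨e, rfl⟩ : {f : E // G.r f = G.r e}) fun f hf =>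
      hg f (hf <| Subtype.ext ·)
  · rw [pointMass_of_ne hv, mul_zero]
    exact hasSum_zero.congr_fun fun f => hg f fun hf => hv (hf ▸ f.2.symm)

open Classical in
theorem single_mem_corrSubmodule (e : E) : (Pi.single e 1 : E → ℂ) ∈ G.corrSubmodule := by
  refine ⟨pointMass (G.r e), fun v => ?_⟩
  have hsum := G.hasSum_fiber_of_support (e := e) (g := fun f => ‖(Pi.single e 1 : E → ℂ) f‖ ^ 2)
    (fun f hf => by simp [hf]) v
  simpa using hsum

open Classical in
/-- The indicator function of an edge, as an element of the graph correspondence. -/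
def edgeVec (e : E) : G.correspondence.Carrier :=
  (⟨Pi.single e 1, G.single_mem_corrSubmodule e⟩ : G.corrSubmodule)

theorem inner_edgeVec (e : E) (ξ : G.corrSubmodule) :
    G.correspondence.toPre.inner (G.edgeVec e) ξ = ξ.1 e • pointMass (G.r e) := by
  classical
  ext v
  have hsum := G.hasSum_fiber_of_support (e := e)
    (g := fun f => star ((Pi.single e 1 : E → ℂ) f) * ξ.1 f) (fun f hf => by simp [hf]) v
  rw [Pi.single_eq_same, star_one, one_mul] at hsum
  exact (G.corrInner_apply _ _ v).trans hsum.tsum_eq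

theorem inner_edgeVec_self (e : E) :
    G.correspondence.toPre.inner (G.edgeVec e) (G.edgeVec e) = pointMass (G.r e) := by
  classical
  refine (G.inner_edgeVec e _).trans ?_
  change (Pi.single e 1 : E → ℂ) e • _ = _
  rw [Pi.single_eq_same, one_smul]

theorem inner_edgeVec_of_ne {e f : E} (h : e ≠ f) :
    G.correspondence.toPre.inner (G.edgeVec e) (G.edgeVec f) = 0 := by
  classical
  refine (G.inner_edgeVec e _).trans ?_
  change (Pi.single f 1 : E → ℂ) e • _ = _
  rw [Pi.single_eq_of_ne h, zero_smul]

theorem lact_edgeVec (a : C₀(V, ℂ)) (e : E) :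
    G.correspondence.toPre.lact a (G.edgeVec e) = a (G.s e) • G.edgeVec e := by
  classical
  refine Subtype.ext (funext fun f => ?_)
  change a (G.s f) * (Pi.single e 1 : E → ℂ) f = a (G.s e) * (Pi.single e 1 : E → ℂ) f
  by_cases hf : f = e
  · rw [hf]
  · simp only [Pi.single_eq_of_ne hf, mul_zero]

/-- The elementary tensor `δ_{p 0} ⊗ (δ_{p 1} ⊗ (⋯ ⊗ δ_{p n}))` of indicator functions of edges,
nested as in the tensor power. -/
def pathVec : (n : ℕ) → (ℕ → E) → (G.correspondence.tensorPowSucc n).Carrier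
  | 0, p => G.edgeVec (p 0)
  | n + 1, p => G.correspondence.tmul (G.correspondence.tensorPowSucc n) (G.edgeVec (p 0))
      (pathVec n fun i => p (i + 1))

theorem lact_pathVec (a : C₀(V, ℂ)) : ∀ (n : ℕ) (p : ℕ → E),
    (G.correspondence.tensorPowSucc n).toPre.lact a (G.pathVec n p)
      = a (G.s (p 0)) • G.pathVec n p
  | 0, p => G.lact_edgeVec a (p 0)
  | n + 1, p => by
    refine (CStarCorrespondence.lact_tmul ..).trans ?_
    rw [lact_edgeVec, CStarCorrespondence.smul_tmul]
    rfl

theorem inner_pathVec_of_ne {p q : ℕ → E} (h : p 0 ≠ q 0) : ∀ n,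
    (G.correspondence.tensorPowSucc n).toPre.inner (G.pathVec n p) (G.pathVec n q) = 0
  | 0 => G.inner_edgeVec_of_ne h
  | n + 1 => by
    refine (CStarCorrespondence.inner_tmul ..).trans ?_
    rw [G.inner_edgeVec_of_ne h, map_zero, LinearMap.zero_apply, map_zero]

/-- A sequence of edges in which each edge starts where the previous one ends. -/
def IsInfinitePath (p : ℕ → E) : Prop := ∀ i, G.r (p i) = G.s (p (i + 1))

variable {G}

theorem IsInfinitePath.inner_pathVec_self : ∀ (n : ℕ) {p : ℕ → E}, G.IsInfinitePath p →
    (G.correspondence.tensorPowSucc n).toPre.inner (G.pathVec n p) (G.pathVec n p)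
      = pointMass (G.r (p n))
  | 0, p, _ => G.inner_edgeVec_self (p 0)
  | n + 1, p, hp => by
    refine (CStarCorrespondence.inner_tmul ..).trans ?_
    rw [G.inner_edgeVec_self, lact_pathVec, hp 0, pointMass_self, one_smul]
    exact inner_pathVec_self n fun i => hp (i + 1)

end ElementaryTensors

section Periodic

variable {V E : Type*} [TopologicalSpace V] [DiscreteTopology V] {G : DirectedGraph V E} {n : ℕ}

theorem source_surjective_of_isIsomorphic_self
    (h : (G.correspondence.tensorPowSucc n).IsIsomorphic (.self C₀(V, ℂ))) :
    Function.Surjective G.s := by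
  intro v
  by_contra! hv
  have hzero : G.correspondence.toPre.lact (pointMass v) = 0 := by
    refine LinearMap.ext fun ξ => Subtype.ext (funext fun e => ?_)
    change pointMass v (G.s e) * ξ.1 e = 0
    rw [pointMass_of_ne (hv e), zero_mul]
  exact pointMass_ne_zero v
    (h.eq_zero_of_lact_eq_zero (CStarCorrespondence.lact_tensorPowSucc_eq_zero hzero n))

theorem IsInfinitePath.range_eq_source_of_isIsomorphic_self {p : ℕ → E} (hp : G.IsInfinitePath p)
    (h : (G.correspondence.tensorPowSucc n).IsIsomorphic (.self C₀(V, ℂ))) :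
    G.r (p n) = G.s (p 0) := by
  have hmul : (pointMass (G.r (p n)) : C₀(V, ℂ)) =
      pointMass (G.s (p 0)) * pointMass (G.r (p n)) := by
    have hlact := h.inner_lact_eq_mul (pointMass (G.s (p 0))) (G.pathVec n p) (G.pathVec n p)
    rwa [lact_pathVec, pointMass_self, one_smul, hp.inner_pathVec_self] at hlact
  have hval := DFunLike.congr_fun hmul (G.r (p n))
  rw [ZeroAtInftyContinuousMap.mul_apply, pointMass_self, mul_one] at hval
  by_contra hne
  exact one_ne_zero (hval.trans (pointMass_of_ne hne))

theorem IsInfinitePath.eq_of_source_eq_of_isIsomorphic_self {p q : ℕ → E}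
    (hp : G.IsInfinitePath p) (hq : G.IsInfinitePath q) (hpq : G.s (p 0) = G.s (q 0))
    (h : (G.correspondence.tensorPowSucc n).IsIsomorphic (.self C₀(V, ℂ))) : p 0 = q 0 := by
  by_contra hne
  have hrange : G.r (p n) = G.r (q n) :=
    (hp.range_eq_source_of_isIsomorphic_self h).trans
      (hpq.trans (hq.range_eq_source_of_isIsomorphic_self h).symm)
  have hmul : (0 : C₀(V, ℂ)) = pointMass (G.r (p n)) * pointMass (G.r (q n)) := by
    have hinner := h.inner_mul_inner_comm (G.pathVec n p) (G.pathVec n q)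
    rwa [inner_pathVec_of_ne G hne, zero_mul, hp.inner_pathVec_self, hq.inner_pathVec_self]
      at hinner
  have hval := DFunLike.congr_fun hmul (G.r (q n))
  rw [hrange, ZeroAtInftyContinuousMap.mul_apply, pointMass_self, mul_one] at hval
  exact zero_ne_one hval

end Periodic

section Paths

variable {V E : Type*} {G : DirectedGraph V E}

theorem IsInfinitePath.exists_isCycle {p : ℕ → E} (hp : G.IsInfinitePath p) {n : ℕ}
    (h : G.r (p n) = G.s (p 0)) : ∃ α : G.Path, α.IsCycle := by
  refine ⟨⟨(List.range (n + 1)).map p, by simp, ?_⟩, ?_⟩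
  · rw [List.isChain_iff_getElem]
    intro i hi
    simpa only [List.getElem_map, List.getElem_range] using hp i
  · simp [Path.IsCycle, Path.source, Path.range, List.getLast_map, List.head_map, h]

theorem ConditionL.nonperiodic [TopologicalSpace V] [DiscreteTopology V] [Nonempty V]
    (hL : G.ConditionL) : G.correspondence.Nonperiodic := by
  rintro (_ | n) h
  · rfl
  change (G.correspondence.tensorPowSucc n).IsIsomorphic (.self C₀(V, ℂ)) at h
  exfalso
  have hs := source_surjective_of_isIsomorphic_self h
  choose next hnext using fun e => hs (G.r e)
  have hpath (e : E) : G.IsInfinitePath fun i => next^[i] e := fun i => by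
    simp only [Function.iterate_succ_apply', hnext]
  obtain ⟨e, -⟩ := hs (Classical.arbitrary V)
  obtain ⟨α, hα⟩ := (hpath e).exists_isCycle ((hpath e).range_eq_source_of_isIsomorphic_self h)
  obtain ⟨f, e', -, hfe', hne⟩ := hL α hα
  exact hne ((hpath f).eq_of_source_eq_of_isIsomorphic_self (hpath e') hfe' h)

theorem Path.range_mem {S : Set V} (hS : ∀ e, G.s e ∈ S → G.r e ∈ S) (α : G.Path)
    (hα : α.source ∈ S) : α.range ∈ S := by
  obtain ⟨l, hl, hchain⟩ := α
  change G.s (l.head hl) ∈ S at hα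
  change G.r (l.getLast hl) ∈ S
  induction l with
  | nil => exact absurd rfl hl
  | cons e l ih =>
    cases l with
    | nil => exact hS e hα
    | cons f l =>
      obtain ⟨hef, hchain⟩ := List.isChain_cons_cons.1 hchain
      rw [List.getLast_cons_cons]
      exact ih _ hchain (hef ▸ hS e hα)

theorem Path.IsCycle.exists_source_eq_range {α : G.Path} (hα : α.IsCycle) {e : E}
    (he : e ∈ α.edges) : ∃ f ∈ α.edges, G.s f = G.r e := by
  obtain ⟨i, hi, rfl⟩ := List.getElem_of_mem he
  by_cases hlast : i + 1 < α.edges.length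
  · exact ⟨_, List.getElem_mem hlast, (List.isChain_iff_getElem.1 α.chain i hlast).symm⟩
  · have hi' : i = α.edges.length - 1 := by lia
    refine ⟨_, List.head_mem α.ne_nil, Eq.trans hα ?_⟩
    simp only [Path.range, List.getLast_eq_getElem, hi']

namespace StronglyConnected

theorem mem_of_forall_range_mem (hG : G.StronglyConnected) {S : Set V} (hne : S.Nonempty)
    (hS : ∀ e, G.s e ∈ S → G.r e ∈ S) (v : V) : v ∈ S := by
  obtain ⟨w, hw⟩ := hne
  obtain rfl | ⟨α, rfl, rfl⟩ := hG w v
  · exact hw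
  · exact α.range_mem hS hw

theorem source_surjective [Nonempty E] (hG : G.StronglyConnected) :
    Function.Surjective G.s := by
  intro v
  obtain ⟨e⟩ := ‹Nonempty E›
  obtain rfl | ⟨α, hα, -⟩ := hG v (G.s e)
  · exact ⟨e, rfl⟩
  · exact ⟨_, hα⟩

theorem range_surjective [Nonempty E] (hG : G.StronglyConnected) : Function.Surjective G.r :=
  hG.mem_of_forall_range_mem (Set.range_nonempty G.r) fun e _ => Set.mem_range_self e

theorem isSimpleCycle_of_injective [Finite E] [Nonempty E] (hG : G.StronglyConnected)
    (hs : Function.Injective G.s) : G.IsSimpleCycle := by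
  let σ : E ≃ V := .ofBijective G.s ⟨hs, hG.source_surjective⟩
  let next (e : E) : E := σ.symm (G.r e)
  have hnext (e : E) : G.s (next e) = G.r e := σ.apply_symm_apply (G.r e)
  have hinj : Function.Injective next :=
    Finite.injective_iff_surjective.2 (σ.symm.surjective.comp hG.range_surjective)
  let e₀ := Classical.arbitrary E
  have horbit (e : E) : ∃ i, next^[i] e₀ = e := by
    refine (hG.mem_of_forall_range_mem (S := Set.range fun i => G.s (next^[i] e₀))
      (Set.range_nonempty _) ?_ (G.s e)).imp fun i hi => hs hi
    rintro f ⟨i, hi⟩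
    refine ⟨i + 1, ?_⟩
    change G.s (next^[i + 1] e₀) = G.r f
    rw [Function.iterate_succ_apply', hnext, hs hi]
  obtain ⟨n, e, he⟩ := exists_equiv_fin_of_mem_periodicPts (hinj.mem_periodicPts e₀) horbit
  exact ⟨n, e.trans σ, e, fun i => ⟨rfl, (hnext (e i)).symm.trans (congrArg G.s (he i))⟩⟩

theorem isSimpleCycle_of_not_conditionL (hG : G.StronglyConnected) (hL : ¬ G.ConditionL) :
    G.IsSimpleCycle := by
  unfold ConditionL Path.IsExit at hL
  push Not at hL
  obtain ⟨α, hα, hexit⟩ := hL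
  have hmem (e : E) : e ∈ α.edges := by
    obtain ⟨f, hf, hfe⟩ := hG.mem_of_forall_range_mem (S := G.s '' {f | f ∈ α.edges})
      ⟨_, _, List.head_mem α.ne_nil, rfl⟩ (by
        rintro e ⟨f, hf, hfe⟩
        rw [hexit e f hf hfe.symm]
        exact hα.exists_source_eq_range hf) (G.s e)
    rwa [hexit e f hf hfe.symm]
  have _ : Finite E := .of_surjective α.edges.get fun e => List.mem_iff_get.1 (hmem e)
  have _ : Nonempty E := ⟨α.edges.head α.ne_nil⟩
  exact hG.isSimpleCycle_of_injective fun e f hef => hexit e f (hmem f) hef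

end StronglyConnected

end Paths

end DirectedGraph

end

theorem mainTheorem7_general {V E : Type*} [TopologicalSpace V] [DiscreteTopology V] [Nonempty V]
    (G : DirectedGraph V E) (hG : G.StronglyConnected) :
    List.TFAE [G.correspondence.Nonperiodic, ¬ G.IsSimpleCycle, G.ConditionL] := by
  tfae_have 1 → 2 := fun hX hC => hC.not_nonperiodic hX
  tfae_have 2 → 3 := fun hC => by_contra fun hL => hC (hG.isSimpleCycle_of_not_conditionL hL)
  tfae_have 3 → 1 := DirectedGraph.ConditionL.nonperiodic
  tfae_finish

theorem mainTheorem7 {V E : Type*} [TopologicalSpace V] [DiscreteTopology V] [Finite V] [Nonempty V]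
    (G : DirectedGraph V E) (hG : G.StronglyConnected) :
    List.TFAE [G.correspondence.Nonperiodic, ¬ G.IsSimpleCycle, G.ConditionL] :=
  mainTheorem7_general G hG
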